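/- Let $M$ be a finite von Neumann algebra with separable predual and with a faithful normal trace $\tau$, $\tau(1)=1$, standardly represented on $L^2(M,\tau)$; let $\xi\in L^2(M,\tau)$ be the vector given by $1\in M$, so that $\tau(x)=\langle x\xi,\xi\rangle$ for $x\in M$ and $M\xi$ is dense. Let $B\subseteq M$ be a von Neumann subalgebra with the same unit such that $B'\cap M\subseteq B$, and write $Z(B)=B'\cap B$. Let $e_B$ be the orthogonal projection of $L^2(M,\tau)$ onto the closure $L^2(B)$ of $B\xi$, let $\langle M,e_B\rangle$ be the von Neumann algebra generated by $M$ and $e_B$, and let $\mathrm{Tr}$ be its canonical trace, that is, the unique faithful normal semifinite trace on $\langle M,e_B\rangle$ with $\mathrm{Tr}(xe_By)=\tau(xy)$ for all $x,y\in M$. An intertwiner of $B$ is a partial isometry $v\in M$ with $vBv^*\subseteq B$ and $v^*v\in B$; the set of intertwiners is denoted $\mathcal{GN}^{(1)}(B)$. Let $q\in B$ be a projection, and let $P$ be a projection in $(B'\cap\langle M,e_B\rangle)q=\{xq: x\in B'\cap\langle M,e_B\rangle\}$. Then $P=v^*e_Bv$ for some $v\in\mathcal{GN}^{(1)}(B)$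 if and only if the following two conditions hold: (1) $P\precsim e_B$ in $\langle M,e_B\rangle$, i.e. there is $V\in\langle M,e_B\rangle$ with $V^*V=P$ and $VV^*\le e_B$; (2) $\mathrm{Tr}(Pr)\le\tau(qr)$ for every projection $r\in Z(B)q$. Moreover, whenever $P=v^*e_Bv$ with $v\in\mathcal{GN}^{(1)}(B)$, the projection $v^*v$ lies in $Z(B)q$. -/

import Mathlib

open scoped ENNReal InnerProductSpace

noncomputable section

namespace FiniteInclusion

variable {H : Type*} [NormedAddCommGroup H] [InnerProductSpace ℂ H] [CompleteSpace H]

/-- The von Neumann algebra generated by a set `S` of bounded operators: the double commutant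
of `S ∪ S*`. -/
def generatedBy (S : Set (H →L[ℂ] H)) : VonNeumannAlgebra H where
  toStarSubalgebra := StarSubalgebra.centralizer ℂ (StarSubalgebra.centralizer ℂ S)
  centralizer_centralizer' := by
    simp [Set.centralizer_centralizer_centralizer]

/-- The vector functional `x ↦ ⟨x ξ, ξ⟩`. For `M` in standard form with vector `ξ` this is
the trace `τ`. -/
def vectorTrace (ξ : H) (x : H →L[ℂ] H) : ℂ := ⟪ξ, x ξ⟫_ℂ

/-- `M` is a finite von Neumann algebra standardly represented on `H = L²(M, τ)`, where
`τ(x) = ⟨x ξ, ξ⟩` is a faithful (automatically normal) trace with `τ(1) = 1`, and `ξ` is the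
image of `1 ∈ M` in `H`; thus `‖x ξ‖² = τ(x* x)` for `x ∈ M`, and `M ξ` is dense in `H`. -/
structure IsStandardForm (M : VonNeumannAlgebra H) (ξ : H) : Prop where
  trace_one : vectorTrace ξ 1 = 1
  trace_comm : ∀ x ∈ M, ∀ y ∈ M, vectorTrace ξ (x * y) = vectorTrace ξ (y * x)
  faithful : ∀ x ∈ M, vectorTrace ξ (star x * x) = 0 → x = 0
  dense : Dense {η : H | ∃ x ∈ M, x ξ = η}

/-- `L²(B)`, the closure of `B ξ` in `H`. -/
def l2Subspace (B : VonNeumannAlgebra H) (ξ : H) : Submodule ℂ H :=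
  (B.toStarSubalgebra.toSubalgebra.toSubmodule.map
    (ContinuousLinearMap.apply ℂ H ξ).toLinearMap).topologicalClosure

instance (B : VonNeumannAlgebra H) (ξ : H) : CompleteSpace (l2Subspace B ξ) :=
  (Submodule.isClosed_topologicalClosure _).completeSpace_coe

/-- The Jones projection `e_B`: the orthogonal projection of `H` onto `L²(B)`. -/
def jonesProjection (B : VonNeumannAlgebra H) (ξ : H) : H →L[ℂ] H :=
  (l2Subspace B ξ).starProjection

/-- The basic construction `⟨M, e_B⟩`: the von Neumann algebra generated by `M` and `e_B`. -/
def basicConstruction (M B : VonNeumannAlgebra H) (ξ : H) : VonNeumannAlgebra H :=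
  generatedBy ((M : Set (H →L[ℂ] H)) ∪ {jonesProjection B ξ})

/-- `v` is a partial isometry. -/
def IsPartialIsometry (v : H →L[ℂ] H) : Prop := v * star v * v = v

/-- The canonical trace `Tr` on the positive part of `⟨M, e_B⟩`, the unique faithful normal
semifinite trace with `Tr(x e_B y) = τ(x y)` for `x, y ∈ M`. It is given by
`Tr(t) = ∑ i, ⟨t (vᵢ* ξ), vᵢ* ξ⟩` for any family of partial isometries `vᵢ ∈ ⟨M, e_B⟩` with
`∑ i, vᵢ* e_B vᵢ = 1`; here this is written as the supremum of the same sum over all finite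
families with `∑ i, vᵢ* e_B vᵢ ≤ 1`. (Every such sum equals `∑ i, Tr (t^½ vᵢ* e_B vᵢ t^½)`, so
it is at most `Tr t`, and the finite parts of a family that sums to `1` approach `Tr t`.)
Only its values at positive `t ∈ ⟨M, e_B⟩` are meaningful. -/
def canonicalTrace (M B : VonNeumannAlgebra H) (ξ : H) (t : H →L[ℂ] H) : ℝ≥0∞ :=
  ⨆ (n : ℕ) (v : Fin n → H →L[ℂ] H)
    (_ : (∀ i, v i ∈ basicConstruction M B ξ ∧ IsPartialIsometry (v i)) ∧
      ∑ i, star (v i) * jonesProjection B ξ * v i ≤ 1),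
    ∑ i, ENNReal.ofReal (⟪star (v i) ξ, t (star (v i) ξ)⟫_ℂ).re

/-- Murray–von Neumann subequivalence `p ≾ e` of projections in `N`. -/
def Subequivalent (N : VonNeumannAlgebra H) (p e : H →L[ℂ] H) : Prop :=
  ∃ V ∈ N, star V * V = p ∧ V * star V ≤ e

/-- The intertwiners `GN⁽¹⁾(B)` of `B` in `M`: partial isometries `v ∈ M` with
`v B v* ⊆ B` and `v* v ∈ B`. -/
def intertwiners (M B : VonNeumannAlgebra H) : Set (H →L[ℂ] H) :=
  {v | v ∈ M ∧ IsPartialIsometry v ∧ (∀ b ∈ B, v * b * star v ∈ B) ∧ star v * v ∈ B}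

/-- The relative commutant `B' ∩ N`. -/
def relativeCommutant (B N : VonNeumannAlgebra H) : Set (H →L[ℂ] H) :=
  {x | x ∈ B.commutant ∧ x ∈ N}

/-- The centre `Z(B) = B' ∩ B`. -/
def centre (B : VonNeumannAlgebra H) : Set (H →L[ℂ] H) := relativeCommutant B B

/-- The set `S q = {x q : x ∈ S}`. -/
def cutDown (S : Set (H →L[ℂ] H)) (q : H →L[ℂ] H) : Set (H →L[ℂ] H) :=
  {y | ∃ x ∈ S, y = x * q}

end FiniteInclusion

end

noncomputable section

namespace FiniteInclusion

variable {H : Type*} [NormedAddCommGroup H] [InnerProductSpace ℂ H] [CompleteSpace H]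

/-! ### The modular conjugation -/

/-! Necessity is direct. If P = v* e_B v, then V = e_B v gives (1), and `canonicalTrace_le` at w = v
r gives Tr(Pr) ≤ τ(r v*v r) ≤ τ(r), which is (2). The projection v*v commutes with the corner qBq;
`mem_cutDown_of_commute_corner` and B' ∩ M ⊆ B then place it in Z(B)q.

For the converse, let V implement (1) and put η = V*ξ. The corner at e_B of the commutant of JBJ is
B e_B (`exists_mem_mul_jonesProjection`), so V b V* = c e_B with c ∈ B. Since P commutes with qBq,
the left action of qBq on η is therefore a right action by elements of B. If η = yξ with y ∈ M, then
V* = y e_B and v = y* is the required intertwiner.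

A priori y is only an unbounded operator affiliated with M, and (2) is what bounds it. Condition (2)
yields ‖rη‖ ≤ ‖rξ‖ for projections r in Z(B)q, and these include all projections of (qBq)' ∩ M below
q. `norm_apply_le_of_forall_projection` turns this into ‖y‖ ≤ 1. It uses the projection onto the
closed graph of y, whose lower right entry t is formally yy*(1 + yy*)⁻¹. This t is bounded, lies in
M and commutes with qBq, so the support of (t - 1/2)⁺, cut down by q, is an admissible r, and the
inequality forces (t - 1/2)⁺q = 0. -/

/-- The map `x ↦ x ξ` on a von Neumann algebra. -/
def evalAt (A : VonNeumannAlgebra H) (ξ : H) : A.toStarSubalgebra →ₗ[ℂ] H where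
  toFun x := (x : H →L[ℂ] H) ξ
  map_add' _ _ := rfl
  map_smul' _ _ := rfl

/-- The conjugate-linear map `x ↦ x* ξ` on a von Neumann algebra. -/
def starEvalAt (A : VonNeumannAlgebra H) (ξ : H) :
    A.toStarSubalgebra →ₛₗ[starRingEnd ℂ] H where
  toFun x := star (x : H →L[ℂ] H) ξ
  map_add' x y := by simp
  map_smul' c x := by simp

/-- The modular conjugation `J`, the continuous extension of `x ξ ↦ x* ξ`. -/
def modularConj (M : VonNeumannAlgebra H) (ξ : H) : H →SL[starRingEnd ℂ] H :=
  (starEvalAt M ξ).extendOfNorm (evalAt M ξ)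

/-- The operator `J y J`. -/
def conjOp (M : VonNeumannAlgebra H) (ξ : H) (y : H →L[ℂ] H) : H →L[ℂ] H :=
  (modularConj M ξ).comp (y.comp (modularConj M ξ))

@[simp]
theorem conjOp_apply (M : VonNeumannAlgebra H) (ξ : H) (y : H →L[ℂ] H) (ζ : H) :
    conjOp M ξ y ζ = modularConj M ξ (y (modularConj M ξ ζ)) := rfl

theorem inner_star_apply (x : H →L[ℂ] H) (a b : H) : ⟪star x a, b⟫_ℂ = ⟪a, x b⟫_ℂ := by
  rw [ContinuousLinearMap.star_eq_adjoint, ContinuousLinearMap.adjoint_inner_left]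

theorem inner_apply_star (x : H →L[ℂ] H) (a b : H) : ⟪a, star x b⟫_ℂ = ⟪x a, b⟫_ℂ := by
  rw [ContinuousLinearMap.star_eq_adjoint, ContinuousLinearMap.adjoint_inner_right]

theorem mem_of_forall_commutant {A : VonNeumannAlgebra H} {a : H →L[ℂ] H}
    (h : ∀ x ∈ A.commutant, x * a = a * x) : a ∈ A := by
  rw [← A.commutant_commutant]
  exact VonNeumannAlgebra.mem_commutant_iff.2 h

/-- An operator bound on a vector relative to a vector that is cyclic for the commutant gives an
element of the algebra. -/
theorem exists_mem_apply_eq {A : VonNeumannAlgebra H} {ξ η : H} {C : ℝ}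
    (hd : Dense {ζ : H | ∃ x ∈ A.commutant, x ξ = ζ})
    (hη : ∀ x ∈ A.commutant, ‖x η‖ ≤ C * ‖x ξ‖) :
    ∃ a ∈ A, a ξ = η ∧ ∀ ζ, ‖a ζ‖ ≤ C * ‖ζ‖ := by
  have hd' : DenseRange (evalAt A.commutant ξ) := by
    refine hd.mono ?_
    rintro _ ⟨x, hx, rfl⟩
    exact ⟨⟨x, hx⟩, rfl⟩
  have hb : ∀ x, ‖evalAt A.commutant η x‖ ≤ C * ‖evalAt A.commutant ξ x‖ :=
    fun x => hη x x.2
  set a : H →L[ℂ] H := (evalAt A.commutant η).extendOfNorm (evalAt A.commutant ξ) with ha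
  have key : ∀ x ∈ A.commutant, a (x ξ) = x η := fun x hx =>
    LinearMap.extendOfNorm_eq hd' ⟨C, hb⟩ (⟨x, hx⟩ : A.commutant.toStarSubalgebra)
  refine ⟨a, mem_of_forall_commutant fun x hx => ?_, ?_, fun ζ =>
    LinearMap.norm_extendOfNorm_apply_le hd' C hb ζ⟩
  · refine ContinuousLinearMap.ext_on (hd.mono Submodule.subset_span) ?_
    rintro _ ⟨y, hy, rfl⟩
    have h2 := key (x * y) (mul_mem hx hy)
    simp only [mul_apply_eq_comp] at h2 ⊢
    rw [h2, key y hy]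
  · simpa using key 1 (one_mem _)

namespace IsStandardForm

variable {M : VonNeumannAlgebra H} {ξ : H} (hM : IsStandardForm M ξ)
include hM

theorem inner_trace {x y : H →L[ℂ] H} (hx : x ∈ M) (hy : y ∈ M) :
    ⟪x ξ, y ξ⟫_ℂ = ⟪star y ξ, star x ξ⟫_ℂ := by
  have := hM.trace_comm (star x) (star_mem hx) y hy
  simp only [vectorTrace, mul_apply_eq_comp] at this
  rw [inner_apply_star] at this
  rw [this, inner_star_apply]

theorem norm_star_apply {x : H →L[ℂ] H} (hx : x ∈ M) : ‖star x ξ‖ = ‖x ξ‖ := by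
  have := hM.inner_trace hx hx
  rw [inner_self_eq_norm_sq_to_K, inner_self_eq_norm_sq_to_K] at this
  have h2 : ‖x ξ‖ ^ 2 = ‖star x ξ‖ ^ 2 := by exact_mod_cast this
  exact ((sq_eq_sq₀ (norm_nonneg _) (norm_nonneg _)).1 h2).symm

theorem eq_zero_of_apply {x : H →L[ℂ] H} (hx : x ∈ M) (h : x ξ = 0) : x = 0 := by
  refine hM.faithful x hx ?_
  simp [vectorTrace, h]

theorem eq_of_apply {x y : H →L[ℂ] H} (hx : x ∈ M) (hy : y ∈ M) (h : x ξ = y ξ) : x = y :=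
  sub_eq_zero.1 (hM.eq_zero_of_apply (sub_mem hx hy) (by simp [h]))

theorem denseRange_evalAt : DenseRange (evalAt M ξ) := by
  refine hM.dense.mono ?_
  rintro _ ⟨x, hx, rfl⟩
  exact ⟨⟨x, hx⟩, rfl⟩

theorem modularConj_apply {x : H →L[ℂ] H} (hx : x ∈ M) :
    modularConj M ξ (x ξ) = star x ξ :=
  LinearMap.extendOfNorm_eq (f := starEvalAt M ξ) hM.denseRange_evalAt
    ⟨1, fun y => by simpa using! (hM.norm_star_apply y.2).le⟩
    (⟨x, hx⟩ : M.toStarSubalgebra)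

theorem modularConj_self : modularConj M ξ ξ = ξ := by
  simpa using hM.modularConj_apply (one_mem M)

theorem modularConj_modularConj (ζ : H) : modularConj M ξ (modularConj M ξ ζ) = ζ := by
  refine hM.dense.induction (P := fun ζ => modularConj M ξ (modularConj M ξ ζ) = ζ) ?_
    (isClosed_eq (by fun_prop) (by fun_prop)) ζ
  rintro _ ⟨x, hx, rfl⟩
  rw [hM.modularConj_apply hx, hM.modularConj_apply (star_mem hx), star_star]

theorem inner_modularConj (a b : H) :
    ⟪modularConj M ξ a, modularConj M ξ b⟫_ℂ = ⟪b, a⟫_ℂ := by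
  refine hM.dense.induction
    (P := fun a => ⟪modularConj M ξ a, modularConj M ξ b⟫_ℂ = ⟪b, a⟫_ℂ) ?_
    (isClosed_eq (by fun_prop) (by fun_prop)) a
  rintro _ ⟨x, hx, rfl⟩
  refine hM.dense.induction
    (P := fun b => ⟪modularConj M ξ (x ξ), modularConj M ξ b⟫_ℂ = ⟪b, x ξ⟫_ℂ) ?_
    (isClosed_eq (by fun_prop) (by fun_prop)) b
  rintro _ ⟨y, hy, rfl⟩
  rw [hM.modularConj_apply hx, hM.modularConj_apply hy, hM.inner_trace hy hx]

theorem inner_modularConj_left (a b : H) :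
    ⟪modularConj M ξ a, b⟫_ℂ = ⟪modularConj M ξ b, a⟫_ℂ := by
  conv_lhs => rw [← hM.modularConj_modularConj b]
  rw [hM.inner_modularConj]

theorem norm_modularConj (a : H) : ‖modularConj M ξ a‖ = ‖a‖ := by
  have := hM.inner_modularConj a a
  rw [inner_self_eq_norm_sq_to_K, inner_self_eq_norm_sq_to_K] at this
  have h2 : ‖modularConj M ξ a‖ ^ 2 = ‖a‖ ^ 2 := by exact_mod_cast this
  exact (sq_eq_sq₀ (norm_nonneg _) (norm_nonneg _)).1 h2

theorem star_conjOp (y : H →L[ℂ] H) : star (conjOp M ξ y) = conjOp M ξ (star y) := by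
  refine ContinuousLinearMap.ext fun b => ext_inner_left ℂ fun a => ?_
  rw [inner_apply_star, conjOp_apply, conjOp_apply, hM.inner_modularConj_left,
    ← inner_star_apply, ← hM.inner_modularConj, hM.modularConj_modularConj]

theorem conjOp_apply_self {y : H →L[ℂ] H} (hy : y ∈ M) : conjOp M ξ y ξ = star y ξ := by
  rw [conjOp_apply, hM.modularConj_self, hM.modularConj_apply hy]

/-- On M ξ the operator J y J is right multiplication: z ξ ↦ z y* ξ. Left and right multiplications
commute. -/
theorem conjOp_mem_commutant {y : H →L[ℂ] H} (hy : y ∈ M) : conjOp M ξ y ∈ M.commutant := by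
  refine VonNeumannAlgebra.mem_commutant_iff.2 fun x hx =>
    ContinuousLinearMap.ext_on (hM.dense.mono Submodule.subset_span) ?_
  rintro _ ⟨z, hz, rfl⟩
  simp only [mul_apply_eq_comp, conjOp_apply]
  have h1 : y (star z ξ) = (y * star z) ξ := rfl
  have h2 : x (z ξ) = (x * z) ξ := rfl
  have h3 : y (star (x * z) ξ) = (y * star (x * z)) ξ := rfl
  rw [hM.modularConj_apply hz, h1, hM.modularConj_apply (mul_mem hy (star_mem hz)), h2,
    hM.modularConj_apply (mul_mem hx hz), h3,
    hM.modularConj_apply (mul_mem hy (star_mem (mul_mem hx hz)))]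
  simp

theorem dense_commutant : Dense {ζ : H | ∃ x ∈ M.commutant, x ξ = ζ} := by
  refine hM.dense.mono ?_
  rintro _ ⟨x, hx, rfl⟩
  exact ⟨conjOp M ξ (star x), hM.conjOp_mem_commutant (star_mem hx), by
    rw [hM.conjOp_apply_self (star_mem hx), star_star]⟩

theorem modularConj_apply_commutant {x : H →L[ℂ] H} (hx : x ∈ M.commutant) :
    modularConj M ξ (x ξ) = star x ξ := by
  refine hM.dense.eq_of_inner_right (𝕜 := ℂ) ?_
  rintro _ ⟨a, ha, rfl⟩
  rw [inner_apply_star, ← inner_conj_symm, hM.inner_modularConj_left, hM.modularConj_apply ha,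
    inner_star_apply, inner_conj_symm]
  have := VonNeumannAlgebra.mem_commutant_iff.1 hx a ha
  calc ⟪a (x ξ), ξ⟫_ℂ = ⟪(a * x) ξ, ξ⟫_ℂ := rfl
    _ = _ := by rw [this]; rfl

end IsStandardForm

/-! ### Projections onto invariant subspaces -/

theorem starProjection_mul_of_invariant (K : Submodule ℂ H) [K.HasOrthogonalProjection]
    {S : H →L[ℂ] H} (h : ∀ ζ ∈ K, S ζ ∈ K) (h' : ∀ ζ ∈ K, star S ζ ∈ K) :
    K.starProjection * S = S * K.starProjection := by
  refine ContinuousLinearMap.ext fun ζ => ?_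
  simp only [mul_apply_eq_comp]
  refine Submodule.eq_starProjection_of_mem_of_inner_eq_zero
    (h _ (Submodule.starProjection_apply_mem K ζ)) fun w hw => ?_
  rw [← map_sub, ← inner_conj_symm, ← inner_star_apply, inner_conj_symm]
  exact Submodule.starProjection_inner_eq_zero _ _ (h' w hw)

omit [CompleteSpace H] in
theorem mem_topologicalClosure_of_forall {K L : Submodule ℂ H} {S : H →L[ℂ] H}
    (h : ∀ ζ ∈ K, S ζ ∈ L) : ∀ ζ ∈ K.topologicalClosure, S ζ ∈ L.topologicalClosure :=
  fun _ hζ => map_mem_closure S.continuous hζ h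

/-! ### The Jones projection -/

section Jones

variable {B : VonNeumannAlgebra H} {ξ : H}

theorem apply_mem_l2Subspace {b : H →L[ℂ] H} (hb : b ∈ B) : b ξ ∈ l2Subspace B ξ :=
  Submodule.le_topologicalClosure _ ⟨b, hb, rfl⟩

theorem l2Subspace_induction {p : H → Prop} (hp : IsClosed {ζ | p ζ})
    (h : ∀ b ∈ B, p (b ξ)) : ∀ ζ ∈ l2Subspace B ξ, p ζ := by
  refine fun ζ hζ => closure_minimal (t := {ζ | p ζ}) ?_ hp hζ
  rintro _ ⟨b, hb, rfl⟩
  exact h b hb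

theorem jonesProjection_isStarProjection : IsStarProjection (jonesProjection B ξ) :=
  isStarProjection_starProjection

theorem star_jonesProjection : star (jonesProjection B ξ) = jonesProjection B ξ :=
  jonesProjection_isStarProjection.isSelfAdjoint.star_eq

theorem jonesProjection_mul_self :
    jonesProjection B ξ * jonesProjection B ξ = jonesProjection B ξ :=
  jonesProjection_isStarProjection.isIdempotentElem

theorem jonesProjection_apply {b : H →L[ℂ] H} (hb : b ∈ B) :
    jonesProjection B ξ (b ξ) = b ξ :=
  Submodule.starProjection_eq_self_iff.2 (apply_mem_l2Subspace hb)

theorem jonesProjection_self : jonesProjection B ξ ξ = ξ := by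
  simpa using jonesProjection_apply (one_mem B) (ξ := ξ)

theorem apply_l2Subspace_mem {b : H →L[ℂ] H} (hb : b ∈ B) :
    ∀ ζ ∈ l2Subspace B ξ, b ζ ∈ l2Subspace B ξ := by
  refine mem_topologicalClosure_of_forall ?_
  rintro _ ⟨c, hc, rfl⟩
  exact ⟨b * c, B.mul_mem' hb hc, rfl⟩

theorem jonesProjection_mul {b : H →L[ℂ] H} (hb : b ∈ B) :
    jonesProjection B ξ * b = b * jonesProjection B ξ :=
  starProjection_mul_of_invariant _ (apply_l2Subspace_mem hb)
    (apply_l2Subspace_mem (star_mem hb))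

/-- Two operators supported on `L²(B)` agree if they agree on `B ξ`. -/
theorem eq_of_mul_jonesProjection {S T : H →L[ℂ] H} (hS : S * jonesProjection B ξ = S)
    (hT : T * jonesProjection B ξ = T) (h : ∀ b ∈ B, S (b ξ) = T (b ξ)) : S = T := by
  have := l2Subspace_induction (B := B) (ξ := ξ) (p := fun ζ => S ζ = T ζ)
    (isClosed_eq (by fun_prop) (by fun_prop)) h
  rw [← hS, ← hT]
  exact ContinuousLinearMap.ext fun ζ => this _ (Submodule.starProjection_apply_mem _ ζ)

theorem subset_generatedBy (S : Set (H →L[ℂ] H)) : S ⊆ (generatedBy S : Set (H →L[ℂ] H)) :=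
  fun _ hx => StarAlgebra.adjoin_le_centralizer_centralizer ℂ S
    (StarAlgebra.subset_adjoin ℂ S hx)

theorem mem_basicConstruction {M : VonNeumannAlgebra H} {x : H →L[ℂ] H} (hx : x ∈ M) :
    x ∈ basicConstruction M B ξ :=
  subset_generatedBy _ (Or.inl hx)

theorem jonesProjection_mem {M : VonNeumannAlgebra H} :
    jonesProjection B ξ ∈ basicConstruction M B ξ :=
  subset_generatedBy _ (Or.inr rfl)

/-- `T` commutes with the right action `J B J` of `B`. -/
def IsRightModular (M B : VonNeumannAlgebra H) (ξ : H) (T : H →L[ℂ] H) : Prop :=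
  ∀ b ∈ B, T * conjOp M ξ b = conjOp M ξ b * T

theorem IsRightModular.mul {M : VonNeumannAlgebra H} {S T : H →L[ℂ] H}
    (hS : IsRightModular M B ξ S) (hT : IsRightModular M B ξ T) :
    IsRightModular M B ξ (S * T) := fun b hb => by
  rw [mul_assoc, hT b hb, ← mul_assoc, hS b hb, mul_assoc]

end Jones

/-! ### Operators commuting with the right action of B, and the corner at e_B. -/

namespace IsStandardForm

variable {M B : VonNeumannAlgebra H} {ξ : H} (hM : IsStandardForm M ξ)
include hM

theorem isRightModular_star {T : H →L[ℂ] H} (hT : IsRightModular M B ξ T) :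
    IsRightModular M B ξ (star T) := fun b hb => by
  have := congrArg star (hT (star b) (star_mem hb))
  rw [star_mul, star_mul, hM.star_conjOp, star_star] at this
  exact this.symm

theorem isRightModular_of_mem (hBM : B ≤ M) {x : H →L[ℂ] H} (hx : x ∈ M) :
    IsRightModular M B ξ x := fun _ hb =>
  VonNeumannAlgebra.mem_commutant_iff.1 (hM.conjOp_mem_commutant (hBM hb)) x hx

theorem modularConj_mem_l2Subspace (hBM : B ≤ M) :
    ∀ ζ ∈ l2Subspace B ξ, modularConj M ξ ζ ∈ l2Subspace B ξ := by
  refine l2Subspace_induction ?_ fun b hb => ?_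
  · exact (Submodule.isClosed_topologicalClosure _).preimage (modularConj M ξ).continuous
  · rw [hM.modularConj_apply (hBM hb)]
    exact apply_mem_l2Subspace (star_mem hb)

theorem jonesProjection_modularConj (hBM : B ≤ M) (ζ : H) :
    jonesProjection B ξ (modularConj M ξ ζ) = modularConj M ξ (jonesProjection B ξ ζ) := by
  refine Submodule.eq_starProjection_of_mem_of_inner_eq_zero
    (hM.modularConj_mem_l2Subspace hBM _ (Submodule.starProjection_apply_mem _ ζ)) fun w hw => ?_
  rw [← map_sub, hM.inner_modularConj_left, ← inner_conj_symm]
  simp only [jonesProjection]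
  rw [Submodule.starProjection_inner_eq_zero _ _ (hM.modularConj_mem_l2Subspace hBM w hw),
    map_zero]

theorem isRightModular_jonesProjection (hBM : B ≤ M) :
    IsRightModular M B ξ (jonesProjection B ξ) := fun b hb => by
  refine ContinuousLinearMap.ext fun ζ => ?_
  have := fun ζ => congrArg (fun T : H →L[ℂ] H => T ζ) (jonesProjection_mul (ξ := ξ) hb)
  simp only [mul_apply_eq_comp, conjOp_apply] at this ⊢
  rw [hM.jonesProjection_modularConj hBM, this, hM.jonesProjection_modularConj hBM]

theorem isRightModular_of_mem_basicConstruction (hBM : B ≤ M) {T : H →L[ℂ] H}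
    (hT : T ∈ basicConstruction M B ξ) : IsRightModular M B ξ T := fun b hb => by
  have hR : ∀ c ∈ B, ∀ x ∈ (M : Set (H →L[ℂ] H)) ∪ {jonesProjection B ξ},
      x * conjOp M ξ c = conjOp M ξ c * x := by
    rintro c hc x (hx | rfl)
    · exact hM.isRightModular_of_mem hBM hx c hc
    · exact hM.isRightModular_jonesProjection hBM c hc
  refine ((StarSubalgebra.mem_centralizer_iff ℂ).1 hT (conjOp M ξ b) ?_).1.symm
  refine (StarSubalgebra.mem_centralizer_iff ℂ).2 fun x hx => ⟨hR b hb x hx, ?_⟩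
  have := congrArg star (hR (star b) (star_mem hb) x hx)
  rw [star_mul, star_mul, hM.star_conjOp, star_star] at this
  exact this.symm

/-- Since e_B ξ = ξ, the hypothesis gives ‖y* ξ‖² = ⟨ξ, y y* ξ⟩ = 0. Identities in the basic
construction thus descend to M by cancelling e_B. -/
theorem eq_zero_of_jonesProjection_mul {y : H →L[ℂ] H} (hy : y ∈ M)
    (h : jonesProjection B ξ * y = 0) : y = 0 := by
  have h1 : ⟪ξ, y (star y ξ)⟫_ℂ = 0 := by
    have := congrArg (fun T : H →L[ℂ] H => T (star y ξ)) h
    simp only [mul_apply_eq_comp, zero_apply] at this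
    rw [← jonesProjection_self (B := B) (ξ := ξ), ← inner_apply_star, star_jonesProjection,
      jonesProjection_self, this, inner_zero_right]
  rw [← inner_star_apply, inner_self_eq_zero] at h1
  exact star_eq_zero.1 (hM.eq_zero_of_apply (star_mem hy) h1)

theorem eq_of_jonesProjection_mul {x y : H →L[ℂ] H} (hx : x ∈ M) (hy : y ∈ M)
    (h : jonesProjection B ξ * x = jonesProjection B ξ * y) : x = y :=
  sub_eq_zero.1 (hM.eq_zero_of_jonesProjection_mul (B := B) (sub_mem hx hy)
    (by rw [mul_sub, h, sub_self]))

theorem eq_of_mul_jonesProjection {x y : H →L[ℂ] H} (hx : x ∈ M) (hy : y ∈ M)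
    (h : x * jonesProjection B ξ = y * jonesProjection B ξ) : x = y := by
  refine star_injective (hM.eq_of_jonesProjection_mul (B := B) (star_mem hx) (star_mem hy) ?_)
  simpa [star_jonesProjection] using congrArg star h

/-- For T outside M, J need not exchange T ξ and T* ξ, but it does so after projecting to L²(B). To
see this, pair with b ξ = J b* J ξ and move J b* J past T. -/
theorem modularConj_jonesProjection_apply (hBM : B ≤ M) {T : H →L[ℂ] H}
    (hT : IsRightModular M B ξ T) :
    modularConj M ξ (jonesProjection B ξ (T ξ)) = jonesProjection B ξ (star T ξ) := by
  rw [← hM.jonesProjection_modularConj hBM]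
  refine sub_eq_zero.1 ?_
  rw [← map_sub]
  refine (Submodule.starProjection_apply_eq_zero_iff _).2 fun w hw => ?_
  revert w
  refine l2Subspace_induction (isClosed_eq (by fun_prop) (by fun_prop)) fun b hb => ?_
  rw [inner_sub_right, inner_apply_star, sub_eq_zero]
  have h1 : b ξ = conjOp M ξ (star b) ξ := by
    rw [hM.conjOp_apply_self (hBM (star_mem hb)), star_star]
  have h2 : T (b ξ) = conjOp M ξ (star b) (T ξ) := by
    rw [h1]
    exact congrArg (fun T : H →L[ℂ] H => T ξ) (hT (star b) (star_mem hb))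
  rw [h2, ← hM.star_conjOp, inner_star_apply, hM.conjOp_apply_self (hBM hb),
    ← hM.inner_modularConj, hM.modularConj_modularConj, hM.modularConj_apply (hBM hb)]

theorem modularConj_apply_corner (hBM : B ≤ M) {T : H →L[ℂ] H} (hT : IsRightModular M B ξ T)
    (h1 : jonesProjection B ξ * T = T) (h2 : T * jonesProjection B ξ = T) :
    modularConj M ξ (T ξ) = star T ξ := by
  have := hM.modularConj_jonesProjection_apply hBM hT
  have h3 : jonesProjection B ξ * star T = star T := by
    simpa [star_jonesProjection] using congrArg star h2
  rwa [← mul_apply_eq_comp, ← mul_apply_eq_comp, h1, h3] at this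

/-- The compressions to `L²(B)` of operators commuting with `B` and with `J B J` commute. -/
theorem commute_corner (hBM : B ≤ M) {S T : H →L[ℂ] H}
    (hS : ∀ b ∈ B, b * S = S * b)
    (hS1 : jonesProjection B ξ * S = S) (hS2 : S * jonesProjection B ξ = S)
    (hT : IsRightModular M B ξ T)
    (hT1 : jonesProjection B ξ * T = T) (hT2 : T * jonesProjection B ξ = T) :
    S * T = T * S := by
  set e := jonesProjection B ξ with he
  set J := modularConj M ξ with hJ
  have JJ : ∀ ζ, J (J ζ) = ζ := hM.modularConj_modularConj
  have Je : ∀ ζ, e (J ζ) = J (e ζ) := hM.jonesProjection_modularConj hBM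
  -- Conjugating by J turns commutation with B into commutation with JBJ, so
  -- `modularConj_apply_corner` applies to S'.
  set S' := conjOp M ξ S with hS'
  have hSm : IsRightModular M B ξ S' := fun b hb => by
    refine ContinuousLinearMap.ext fun ζ => ?_
    have := congrArg (fun T : H →L[ℂ] H => J (T (J ζ))) (hS b hb)
    simp only [mul_apply_eq_comp, hS', conjOp_apply] at this ⊢
    rw [← hJ, JJ, JJ, this]
  have hS1' : e * S' = S' := by
    refine ContinuousLinearMap.ext fun ζ => ?_
    simp only [mul_apply_eq_comp, hS', conjOp_apply]
    rw [← hJ, Je, ← mul_apply_eq_comp, hS1]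
  have hS2' : S' * e = S' := by
    refine ContinuousLinearMap.ext fun ζ => ?_
    simp only [mul_apply_eq_comp, hS', conjOp_apply]
    rw [← hJ, ← Je, ← mul_apply_eq_comp S e, hS2]
  have hSS : ∀ ζ, S ζ = J (S' (J ζ)) := fun ζ => by
    simp only [hS', conjOp_apply]
    rw [← hJ, JJ, JJ]
  have hstar' : ∀ {T : H →L[ℂ] H}, e * T = T → star T * e = star T := fun {T} h => by
    simpa [he, star_jonesProjection] using congrArg star h
  -- S acts on vectors c ξ as a right multiplication: S c ξ = J S' c* ξ = c S'* ξ. Using this for c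
  -- = b e and for c = T b e shows that S and T commute on B ξ.
  have hcor : ∀ c : H →L[ℂ] H, IsRightModular M B ξ c → e * c = c → c * e = c →
      S (c ξ) = c (star S' ξ) := fun c hc h1 h2 => by
    rw [hSS, hJ, hM.modularConj_apply_corner hBM hc h1 h2, ← mul_apply_eq_comp S' (star c),
      hM.modularConj_apply_corner hBM (hSm.mul (hM.isRightModular_star hc))
        (by rw [← mul_assoc, ← he, hS1']) (by rw [mul_assoc, ← he, hstar' h1]),
      star_mul, star_star]
    rfl
  refine FiniteInclusion.eq_of_mul_jonesProjection (B := B) (ξ := ξ)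
    (by rw [mul_assoc, hT2]) (by rw [mul_assoc, hS2]) fun b hb => ?_
  have hbe : IsRightModular M B ξ (b * e) :=
    (hM.isRightModular_of_mem hBM (hBM hb)).mul (hM.isRightModular_jonesProjection hBM)
  have he2 : e * e = e := jonesProjection_mul_self
  have heb : e * (b * e) = b * e := by
    rw [← mul_assoc, he, jonesProjection_mul hb, mul_assoc, jonesProjection_mul_self]
  have hbξ : b ξ = (b * e) ξ := by
    rw [mul_apply_eq_comp, he, jonesProjection_self]
  have k1 := hcor (b * e) hbe heb (by rw [mul_assoc, he2])
  have k2 := hcor (T * (b * e)) (hT.mul hbe) (by rw [← mul_assoc, hT1])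
    (by rw [mul_assoc, mul_assoc, he2])
  simp only [mul_apply_eq_comp T] at k2
  rw [mul_apply_eq_comp, mul_apply_eq_comp, hbξ, k1, k2]

/-- The corner at `e_B` of the commutant of `J B J` is `B e_B`. -/
theorem exists_mem_mul_jonesProjection (hBM : B ≤ M) {T : H →L[ℂ] H}
    (hT : IsRightModular M B ξ T)
    (hT1 : jonesProjection B ξ * T = T) (hT2 : T * jonesProjection B ξ = T) :
    ∃ b ∈ B, T = b * jonesProjection B ξ := by
  set e := jonesProjection B ξ with he
  have hξ : e ξ = ξ := jonesProjection_self
  have hTξ : e (T ξ) = T ξ := by rw [← mul_apply_eq_comp, hT1]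
  have hd : Dense {ζ : H | ∃ x ∈ B.commutant, x ξ = ζ} := by
    refine hM.dense_commutant.mono ?_
    rintro _ ⟨x, hx, rfl⟩
    exact ⟨x, VonNeumannAlgebra.mem_commutant_iff.2 fun g hg =>
      VonNeumannAlgebra.mem_commutant_iff.1 hx g (hBM hg), rfl⟩
  obtain ⟨b, hb, hbξ, -⟩ := exists_mem_apply_eq (A := B) (η := T ξ) (C := ‖T‖) hd (by
    intro x hx
    have hx' := VonNeumannAlgebra.mem_commutant_iff.1 hx
    have hxs := VonNeumannAlgebra.mem_commutant_iff.1 (star_mem hx)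
    -- S lives on L²(B) and commutes with B, so T commutes with S and hence with |x e|. Therefore ‖x
    -- T ξ‖ = ‖T |x e| ξ‖ ≤ ‖T‖ ‖x ξ‖.
    set S := star (x * e) * (x * e) with hS
    have hSe : S = e * star x * x * e := by
      rw [hS, star_mul, he, star_jonesProjection]; simp only [mul_assoc]
    have he2 : e * e = e := jonesProjection_mul_self
    have hcomm : S * T = T * S := by
      refine hM.commute_corner hBM (fun b hb => ?_) ?_ ?_ hT hT1 hT2
      · have hbe : e * b = b * e := jonesProjection_mul hb
        calc b * S = (b * e) * star x * x * e := by rw [hSe]; simp only [mul_assoc]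
          _ = e * (b * star x) * x * e := by rw [← hbe]; simp only [mul_assoc]
          _ = e * star x * (b * x) * e := by rw [hxs b hb]; simp only [mul_assoc]
          _ = e * star x * x * (b * e) := by rw [hx' b hb]; simp only [mul_assoc]
          _ = S * b := by rw [← hbe, hSe]; simp only [mul_assoc]
      · rw [hSe, ← he]; simp only [← mul_assoc, he2]
      · rw [hSe, ← he]; simp only [mul_assoc, he2]
    have hnorm : ∀ ζ, ‖CFC.abs (x * e) ζ‖ = ‖x (e ζ)‖ := fun ζ => by
      have h1 : ⟪CFC.abs (x * e) ζ, CFC.abs (x * e) ζ⟫_ℂ = ⟪x (e ζ), x (e ζ)⟫_ℂ := by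
        have hsa : star (CFC.abs (x * e)) = CFC.abs (x * e) :=
          (CFC.abs_nonneg (x * e)).isSelfAdjoint.star_eq
        rw [← inner_apply_star, hsa, ← mul_apply_eq_comp, CFC.abs_mul_abs, mul_apply_eq_comp,
          inner_apply_star]
        rfl
      rw [inner_self_eq_norm_sq_to_K, inner_self_eq_norm_sq_to_K] at h1
      have h2 : ‖CFC.abs (x * e) ζ‖ ^ 2 = ‖x (e ζ)‖ ^ 2 := by exact_mod_cast h1
      exact (sq_eq_sq₀ (norm_nonneg _) (norm_nonneg _)).1 h2
    have hc : Commute (CFC.abs (x * e)) T := by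
      rw [CFC.abs, CFC.sqrt_eq_cfc]
      exact Commute.cfc_nnreal (show Commute (star (x * e) * (x * e)) T from hcomm) _
    calc ‖x (T ξ)‖ = ‖CFC.abs (x * e) (T ξ)‖ := by rw [hnorm, hTξ]
      _ = ‖T (CFC.abs (x * e) ξ)‖ := by
        rw [← mul_apply_eq_comp, hc.eq, mul_apply_eq_comp]
      _ ≤ ‖T‖ * ‖CFC.abs (x * e) ξ‖ := T.le_opNorm _
      _ = ‖T‖ * ‖x ξ‖ := by rw [hnorm, hξ])
  -- T and b e agree at ξ, and commutation with the right action carries this to all of B ξ.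
  refine ⟨b, hb, FiniteInclusion.eq_of_mul_jonesProjection (B := B) (ξ := ξ) hT2 ?_ ?_⟩
  · rw [mul_assoc, he, jonesProjection_mul_self]
  · intro c hc
    have h1 : c ξ = conjOp M ξ (star c) ξ := by
      rw [hM.conjOp_apply_self (hBM (star_mem hc)), star_star]
    rw [mul_apply_eq_comp, he, jonesProjection_apply hc, h1, ← mul_apply_eq_comp,
      hT _ (star_mem hc), mul_apply_eq_comp, ← hbξ, ← mul_apply_eq_comp, ← mul_apply_eq_comp,
      hM.isRightModular_of_mem hBM (hBM hb) _ (star_mem hc)]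

end IsStandardForm

/-- A projection of `M` below `q` that commutes with the corner `q B q` is cut out of `q` by a
projection of `B' ∩ M`. -/
theorem mem_cutDown_of_commute_corner {M B : VonNeumannAlgebra H} (hBM : B ≤ M)
    {q r : H →L[ℂ] H} (hq : IsStarProjection q) (hqB : q ∈ B) (hrM : r ∈ M)
    (hr : IsStarProjection r) (hqr : q * r = r)
    (hcomm : ∀ b ∈ B, (q * b * q) * r = r * (q * b * q)) :
    r ∈ cutDown (relativeCommutant B M) q := by
  -- The projection z onto the closed span of B r H is the smallest projection of B' that dominates
  -- r. Invariance of this span under M' puts z in M.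
  set K₀ : Submodule ℂ H := Submodule.span ℂ {ζ | ∃ b ∈ B, ∃ ω, b (r ω) = ζ} with hK₀
  set K := K₀.topologicalClosure with hK
  have : CompleteSpace K := (Submodule.isClosed_topologicalClosure _).completeSpace_coe
  have inv : ∀ {S : H →L[ℂ] H}, (∀ b ∈ B, ∀ ω, S (b (r ω)) ∈ K₀) → ∀ ζ ∈ K, S ζ ∈ K := by
    intro S hS
    refine mem_topologicalClosure_of_forall fun ζ hζ => ?_
    refine Submodule.span_induction (p := fun ζ _ => S ζ ∈ K₀) ?_ ?_ ?_ ?_ hζ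
    · rintro _ ⟨b, hb, ω, rfl⟩
      exact hS b hb ω
    · simp
    · intro x y _ _ h1 h2
      rw [map_add]
      exact add_mem h1 h2
    · intro c x _ h1
      rw [map_smul]
      exact Submodule.smul_mem _ _ h1
  have invB : ∀ c ∈ B, ∀ ζ ∈ K, c ζ ∈ K := fun c hc => inv fun b hb ω =>
    Submodule.subset_span ⟨c * b, mul_mem hc hb, ω, rfl⟩
  have invM : ∀ x ∈ M.commutant, ∀ ζ ∈ K, x ζ ∈ K := fun x hx => inv fun b hb ω => by
    refine Submodule.subset_span ⟨b, hb, x ω, ?_⟩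
    have h1 := VonNeumannAlgebra.mem_commutant_iff.1 hx
    simp only [← mul_apply_eq_comp]
    rw [← mul_assoc, h1 _ (mul_mem (hBM hb) hrM)]
  set z := K.starProjection with hz
  have hzs : star z = z := isStarProjection_starProjection.isSelfAdjoint.star_eq
  have hzB : ∀ c ∈ B, z * c = c * z := fun c hc =>
    starProjection_mul_of_invariant K (invB c hc) (invB _ (star_mem hc))
  have hzr : z * r = r := ContinuousLinearMap.ext fun ω =>
    Submodule.starProjection_eq_self_iff.2 (Submodule.le_topologicalClosure _
      (Submodule.subset_span ⟨1, one_mem B, ω, rfl⟩))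
  have hrq : r * q = r := by
    simpa [hq.isSelfAdjoint.star_eq, hr.isSelfAdjoint.star_eq] using congrArg star hqr
  have hrz : r * z = r := by
    simpa [hzs, hr.isSelfAdjoint.star_eq] using congrArg star hzr
  -- As r commutes with q B q, one has q b r = r q b q, so q maps B r H into the range of r. Hence q
  -- z = r.
  have hzero : ∀ ζ ∈ K, (q - r * q) ζ = 0 := by
    refine fun ζ hζ => closure_minimal (s := (K₀ : Set H)) (t := {ζ | (q - r * q) ζ = 0}) ?_
      (isClosed_eq (by fun_prop) (by fun_prop)) hζ
    intro ζ hζ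
    have : K₀ ≤ LinearMap.ker (q - r * q).toLinearMap := by
      refine Submodule.span_le.2 ?_
      rintro _ ⟨b, hb, ω, rfl⟩
      have h2 : (q - r * q) * b * r = 0 := by
        have h3 : q * b * r = r * (q * b * q) := by
          rw [← hcomm b hb, mul_assoc (q * b), hqr]
        have h4 : r * q * b * r = r * (q * b * q) := by
          rw [mul_assoc, mul_assoc, ← mul_assoc q, h3, ← mul_assoc, hr.isIdempotentElem.eq]
        rw [sub_mul, sub_mul, h3, h4, sub_self]
      exact congrArg (fun T : H →L[ℂ] H => T ω) h2
    exact this hζ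
  have hqz : q * z = r := by
    have h1 : (q - r * q) * z = 0 := ContinuousLinearMap.ext fun ω =>
      hzero _ (Submodule.starProjection_apply_mem _ _)
    rw [sub_mul, sub_eq_zero, hrq, hrz] at h1
    exact h1
  refine ⟨z, ⟨VonNeumannAlgebra.mem_commutant_iff.2 fun c hc => (hzB c hc).symm,
    mem_of_forall_commutant fun x hx =>
      (starProjection_mul_of_invariant K (invM x hx) (invM _ (star_mem hx))).symm⟩, ?_⟩
  rw [hzB q hqB, hqz]

/-! ### Projections attached to intertwiners -/

theorem re_inner_apply_of_isStarProjection {p : H →L[ℂ] H} (hp : IsStarProjection p) (ζ : H) :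
    (⟪ζ, p ζ⟫_ℂ).re = ‖p ζ‖ ^ 2 := by
  have h1 : ⟪ζ, p ζ⟫_ℂ = ⟪p ζ, p ζ⟫_ℂ := by
    conv_lhs => rw [← hp.isIdempotentElem.eq, mul_apply_eq_comp, ← inner_star_apply,
      hp.isSelfAdjoint.star_eq]
  rw [h1, inner_self_eq_norm_sq_to_K]
  norm_cast

section CutDown

variable {B : VonNeumannAlgebra H} {A : VonNeumannAlgebra H} {q P : H →L[ℂ] H}

theorem mul_eq_of_mem_cutDown (hq : IsStarProjection q) {S : Set (H →L[ℂ] H)}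
    (hP : P ∈ cutDown S q) : P * q = P := by
  obtain ⟨x, -, rfl⟩ := hP
  rw [mul_assoc, hq.isIdempotentElem.eq]

theorem mul_eq_of_mul_eq (hq : IsStarProjection q) (hP : IsStarProjection P) (h : P * q = P) :
    q * P = P := by
  simpa [hq.isSelfAdjoint.star_eq, hP.isSelfAdjoint.star_eq] using congrArg star h

theorem commute_corner_of_mem_cutDown (hqB : q ∈ B) (hq : IsStarProjection q)
    (hP : P ∈ cutDown (relativeCommutant B A) q) {b : H →L[ℂ] H} (hb : b ∈ B) :
    (q * b * q) * P = P * (q * b * q) := by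
  obtain ⟨x, ⟨hx, -⟩, rfl⟩ := hP
  have hx' := VonNeumannAlgebra.mem_commutant_iff.1 hx
  have h2 := hq.isIdempotentElem.eq
  rw [← hx' q hqB, ← mul_assoc, mul_assoc (q * b), h2, hx' _ (mul_mem (mul_mem hqB hb) hqB),
    hx' q hqB, mul_assoc x, ← mul_assoc q, ← mul_assoc q, h2]

theorem mul_comm_of_mem_cutDown (hqB : q ∈ B)
    (hP : P ∈ cutDown (relativeCommutant B A) q) {r : H →L[ℂ] H}
    (hr : r ∈ cutDown (centre B) q) : P * r = r * P := by
  obtain ⟨x, ⟨hx, -⟩, rfl⟩ := hP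
  obtain ⟨z, ⟨hz, hzB⟩, rfl⟩ := hr
  have hx' := VonNeumannAlgebra.mem_commutant_iff.1 hx
  have hz' := VonNeumannAlgebra.mem_commutant_iff.1 hz
  rw [mul_assoc z, ← mul_assoc q x, hx' q hqB, mul_assoc x q q, ← mul_assoc z, hx' z hzB,
    mul_assoc x, ← mul_assoc q, hz' q hqB]
  simp only [mul_assoc]

end CutDown

omit [CompleteSpace H] in
theorem cutDown_subset {S T : Set (H →L[ℂ] H)} (h : S ⊆ T) (q : H →L[ℂ] H) :
    cutDown S q ⊆ cutDown T q := by
  rintro _ ⟨x, hx, rfl⟩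
  exact ⟨x, h hx, rfl⟩

theorem relativeCommutant_subset_centre {M B : VonNeumannAlgebra H}
    (hcomm : relativeCommutant B M ⊆ (B : Set (H →L[ℂ] H))) :
    relativeCommutant B M ⊆ centre B := fun _ hx => ⟨hx.1, hcomm hx⟩

theorem IsPartialIsometry.isStarProjection {v : H →L[ℂ] H} (hv : IsPartialIsometry v) :
    IsStarProjection (star v * v) where
  isIdempotentElem := by
    unfold IsPartialIsometry at hv
    rw [IsIdempotentElem, mul_assoc, ← mul_assoc v, hv]
  isSelfAdjoint := IsSelfAdjoint.star_mul_self v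

theorem IsPartialIsometry.isStarProjection' {v : H →L[ℂ] H} (hv : IsPartialIsometry v) :
    IsStarProjection (v * star v) where
  isIdempotentElem := by
    unfold IsPartialIsometry at hv
    rw [IsIdempotentElem, ← mul_assoc, hv]
  isSelfAdjoint := IsSelfAdjoint.mul_star_self v

/-! ### Consequences of P = v* e_B v. -/

namespace IsStandardForm

variable {M B : VonNeumannAlgebra H} {ξ : H} (hM : IsStandardForm M ξ)
include hM

theorem star_mul_self_mem_cutDown (hBM : B ≤ M)
    (hcomm : relativeCommutant B M ⊆ (B : Set (H →L[ℂ] H)))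
    {q P v : H →L[ℂ] H} (hqB : q ∈ B) (hq : IsStarProjection q) (hP : IsStarProjection P)
    (hPq : P ∈ cutDown (relativeCommutant B (basicConstruction M B ξ)) q)
    (hv : v ∈ intertwiners M B) (hPv : P = star v * jonesProjection B ξ * v) :
    star v * v ∈ cutDown (centre B) q := by
  obtain ⟨hvM, hvp, hvB, hvv⟩ := hv
  set e := jonesProjection B ξ with he
  have he2 : e * e = e := jonesProjection_mul_self
  have hes : star e = e := star_jonesProjection
  have hPq' := mul_eq_of_mem_cutDown hq hPq
  have hqP := mul_eq_of_mul_eq hq hP hPq'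
  -- With X = e v q - e v, X*X = (1 - q) P (1 - q) = 0; then e cancels.
  have hvq : v * q = v := by
    refine hM.eq_of_jonesProjection_mul (B := B) (mul_mem hvM (hBM hqB)) hvM ?_
    rw [← he, ← sub_eq_zero, ← CStarRing.star_mul_self_eq_zero_iff]
    have h1 : star (e * (v * q) - e * v) * (e * (v * q) - e * v)
        = q * P * q - q * P - (P * q - P) := by
      rw [hPv]
      simp only [star_sub, star_mul, hes, hq.isSelfAdjoint.star_eq, mul_sub, sub_mul, mul_assoc]
      simp only [← mul_assoc e e, he2]
      abel
    rw [h1, hqP, hPq']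
    simp
  have hqv : q * (star v * v) = star v * v := by
    have h1 := congrArg star hvq
    rw [star_mul, hq.isSelfAdjoint.star_eq] at h1
    rw [← mul_assoc, h1]
  -- For a = q b q, v P a = e v a while v a P = e v a v* v. These agree because P commutes with a,
  -- and e cancels.
  have key : ∀ b ∈ B, (v * (q * b * q)) = v * (q * b * q) * star v * v := fun b hb => by
    have hbB : q * b * q ∈ B := mul_mem (mul_mem hqB hb) hqB
    set a := q * b * q with ha
    refine hM.eq_of_jonesProjection_mul (B := B) (mul_mem hvM (hBM hbB))
      (mul_mem (hBM (hvB _ hbB)) hvM) ?_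
    have h1 : a * P = P * a := commute_corner_of_mem_cutDown hqB hq hPq hb
    have h3 : v * star v * e = e * (v * star v) := by
      have := hvB 1 (one_mem B)
      rw [mul_one] at this
      exact (jonesProjection_mul this).symm
    have h4 : v * a * star v * e = e * (v * a * star v) := (jonesProjection_mul (hvB a hbB)).symm
    have h5 : v * (a * P) = e * (v * a * star v * v) := by
      rw [hPv, ← mul_assoc, ← mul_assoc, ← mul_assoc, h4]
      simp only [mul_assoc]
    have h6 : v * (P * a) = e * (v * a) := by
      rw [hPv, ← mul_assoc v, ← mul_assoc v, ← mul_assoc v, h3, mul_assoc e, hvp, mul_assoc]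
    rw [← he, ← h5, ← h6, h1]
  refine cutDown_subset (relativeCommutant_subset_centre hcomm) q
    (mem_cutDown_of_commute_corner hBM hq hqB (hBM hvv) hvp.isStarProjection hqv fun b hb => ?_)
  have h1 : star v * v * (q * b * q) = star v * v * (q * b * q) * (star v * v) := by
    have := congrArg (fun T => star v * T) (key b hb)
    simpa only [mul_assoc] using this
  have h2 : (q * b * q) * (star v * v) = star v * v * (q * b * q) * (star v * v) := by
    have := congrArg (fun T => star (star v * T)) (key (star b) (star_mem hb))
    simpa only [mul_assoc, star_mul, star_star, hq.isSelfAdjoint.star_eq] using this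
  rw [h1, h2]

/-- J is isometric and exchanges the two vectors. This plays the role of the trace property of Tr.
-/
theorem norm_jonesProjection_star (hBM : B ≤ M) {T : H →L[ℂ] H}
    (hT : T ∈ basicConstruction M B ξ) :
    ‖jonesProjection B ξ (star T ξ)‖ = ‖jonesProjection B ξ (T ξ)‖ := by
  rw [← hM.modularConj_jonesProjection_apply hBM
    (hM.isRightModular_of_mem_basicConstruction hBM hT), hM.norm_modularConj]

/-- `Tr (w* e_B w) ≤ τ (w w*)` for `w ∈ M`. -/
theorem canonicalTrace_le (hBM : B ≤ M) {w : H →L[ℂ] H} (hw : w ∈ M) :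
    canonicalTrace M B ξ (star w * jonesProjection B ξ * w) ≤ ENNReal.ofReal (‖w ξ‖ ^ 2) := by
  set e := jonesProjection B ξ with he
  have hee : ∀ ζ, (⟪ζ, e ζ⟫_ℂ).re = ‖e ζ‖ ^ 2 :=
    re_inner_apply_of_isStarProjection jonesProjection_isStarProjection
  refine iSup_le fun n => iSup_le fun v => iSup_le fun ⟨hv, hsum⟩ => ?_
  have h1 : ∀ i, (⟪star (v i) ξ, (star w * e * w) (star (v i) ξ)⟫_ℂ).re
      = ‖e (v i (star w ξ))‖ ^ 2 := fun i => by
    have h2 := hM.norm_jonesProjection_star hBM (T := v i * star w)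
      (mul_mem (hv i).1 (mem_basicConstruction (star_mem hw)))
    simp only [star_mul, star_star, mul_apply_eq_comp] at h2
    rw [← he] at h2
    rw [mul_apply_eq_comp, mul_apply_eq_comp, inner_apply_star, hee, h2]
  -- After `h1` every term is a quadratic form evaluated at the single vector w* ξ, so the
  -- constraint ∑ vᵢ* e vᵢ ≤ 1 bounds the sum.
  have h3 : (∑ i, ‖e (v i (star w ξ))‖ ^ 2) ≤ ‖star w ξ‖ ^ 2 := by
    have h4 := ((ContinuousLinearMap.le_def _ _).1 hsum).re_inner_nonneg_right (star w ξ)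
    have h5 : ∀ i, (⟪star w ξ, (star (v i) * e * v i) (star w ξ)⟫_ℂ).re
        = ‖e (v i (star w ξ))‖ ^ 2 := fun i => by
      rw [mul_apply_eq_comp, mul_apply_eq_comp, inner_apply_star, hee]
    have h6 : (⟪star w ξ, star w ξ⟫_ℂ).re = ‖star w ξ‖ ^ 2 := by
      rw [inner_self_eq_norm_sq_to_K]; norm_cast
    simp only [sub_apply, inner_sub_right, one_apply_eq_self, map_sub,
      sum_apply, inner_sum, map_sum] at h4
    simp only [RCLike.re_eq_complex_re, ← he, h5, h6] at h4
    linarith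
  rw [← ENNReal.ofReal_sum_of_nonneg fun i _ => by rw [h1]; positivity]
  refine ENNReal.ofReal_le_ofReal ?_
  rw [Finset.sum_congr rfl fun i _ => h1 i, ← hM.norm_star_apply hw]
  exact h3

theorem subequivalent_and_trace_le (hBM : B ≤ M)
    {q P v : H →L[ℂ] H} (hqB : q ∈ B) (hq : IsStarProjection q)
    (hPq : P ∈ cutDown (relativeCommutant B (basicConstruction M B ξ)) q)
    (hv : v ∈ intertwiners M B) (hPv : P = star v * jonesProjection B ξ * v) :
    Subequivalent (basicConstruction M B ξ) P (jonesProjection B ξ) ∧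
      ∀ r ∈ cutDown (centre B) q, IsStarProjection r →
        canonicalTrace M B ξ (P * r) ≤ ENNReal.ofReal (vectorTrace ξ (q * r)).re := by
  obtain ⟨hvM, hvp, hvB, hvv⟩ := hv
  have hes : star (jonesProjection B ξ) = jonesProjection B ξ := star_jonesProjection
  have he2 : jonesProjection B ξ * jonesProjection B ξ = jonesProjection B ξ :=
    jonesProjection_mul_self
  refine ⟨⟨jonesProjection B ξ * v, mul_mem jonesProjection_mem (mem_basicConstruction hvM),
    ?_, ?_⟩, fun r hr hrp => ?_⟩
  · rw [star_mul, hes, mul_assoc, ← mul_assoc _ _ v, he2, hPv, mul_assoc]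
  · have h1 := star_right_conjugate_le_conjugate hvp.isStarProjection'.le_one
      (jonesProjection B ξ)
    rw [hes, mul_one, he2] at h1
    rw [star_mul, hes]
    simpa only [mul_assoc] using h1
  · have hrq : r * q = r := mul_eq_of_mem_cutDown hq hr
    have hqr := mul_eq_of_mul_eq hq hrp hrq
    have hrM : r ∈ M := by
      obtain ⟨z, hz, rfl⟩ := hr
      exact hBM (mul_mem hz.2 hqB)
    have hPr : P * r = star (v * r) * jonesProjection B ξ * (v * r) := by
      have h1 := mul_comm_of_mem_cutDown hqB hPq hr
      have h2 : P * r = r * P * r := by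
        rw [← h1, mul_assoc, hrp.isIdempotentElem.eq]
      rw [h2, hPv, star_mul, hrp.isSelfAdjoint.star_eq]
      simp only [mul_assoc]
    rw [hPr]
    refine (hM.canonicalTrace_le hBM (mul_mem hvM hrM)).trans (ENNReal.ofReal_le_ofReal ?_)
    have h3 : (vectorTrace ξ (q * r)).re = ‖r ξ‖ ^ 2 := by
      rw [vectorTrace, hqr, re_inner_apply_of_isStarProjection hrp]
    rw [h3]
    have h5 : ‖v (r ξ)‖ ≤ ‖r ξ‖ := by
      have h7 := (ContinuousLinearMap.le_def _ _).1 hvp.isStarProjection.le_one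
      have h8 := h7.re_inner_nonneg_right (r ξ)
      rw [sub_apply, inner_sub_right, one_apply_eq_self, mul_apply_eq_comp, inner_apply_star,
        inner_self_eq_norm_sq_to_K, inner_self_eq_norm_sq_to_K, map_sub, sub_nonneg] at h8
      have h9 : ‖v (r ξ)‖ ^ 2 ≤ ‖r ξ‖ ^ 2 := by exact_mod_cast h8
      exact (sq_le_sq₀ (norm_nonneg _) (norm_nonneg _)).1 h9
    rw [mul_apply_eq_comp]
    gcongr

end IsStandardForm

/-! ### The graph of the operator `x ξ ↦ x η` -/

/-- The diagonal operator `S ⊕ T` on `H ⊕ H`. -/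
def diagOp (S T : H →L[ℂ] H) : WithLp 2 (H × H) →L[ℂ] WithLp 2 (H × H) :=
  (WithLp.prodContinuousLinearEquiv 2 ℂ H H).symm.toContinuousLinearMap.comp
    ((S.prodMap T).comp (WithLp.prodContinuousLinearEquiv 2 ℂ H H).toContinuousLinearMap)

omit [CompleteSpace H] in
theorem diagOp_apply (S T : H →L[ℂ] H) (k : WithLp 2 (H × H)) :
    diagOp S T k = WithLp.toLp 2 (S k.fst, T k.snd) := rfl

theorem star_diagOp (S T : H →L[ℂ] H) : star (diagOp S T) = diagOp (star S) (star T) := by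
  refine ContinuousLinearMap.ext fun k => ext_inner_left ℂ fun l => ?_
  rw [inner_apply_star, diagOp_apply, diagOp_apply, WithLp.prod_inner_apply,
    WithLp.prod_inner_apply]
  simp [inner_apply_star]

/-- The vector `(0, ζ)` of `H ⊕ H`, as a continuous linear map of `ζ`. -/
def inrL2 : H →L[ℂ] WithLp 2 (H × H) :=
  (WithLp.prodContinuousLinearEquiv 2 ℂ H H).symm.toContinuousLinearMap.comp
    (ContinuousLinearMap.inr ℂ H H)

/-- The vector `(ζ, 0)` of `H ⊕ H`, as a continuous linear map of `ζ`. -/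
def inlL2 : H →L[ℂ] WithLp 2 (H × H) :=
  (WithLp.prodContinuousLinearEquiv 2 ℂ H H).symm.toContinuousLinearMap.comp
    (ContinuousLinearMap.inl ℂ H H)

omit [CompleteSpace H] in
theorem inrL2_apply (ζ : H) : inrL2 ζ = WithLp.toLp 2 ((0 : H), ζ) := rfl

omit [CompleteSpace H] in
theorem inlL2_apply (ζ : H) : inlL2 ζ = WithLp.toLp 2 (ζ, (0 : H)) := rfl

/-- The map `x ↦ (x ξ, x η)`. -/
def graphMap (A : VonNeumannAlgebra H) (ξ η : H) :
    A.toStarSubalgebra →ₗ[ℂ] WithLp 2 (H × H) where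
  toFun x := WithLp.toLp 2 ((x : H →L[ℂ] H) ξ, (x : H →L[ℂ] H) η)
  map_add' _ _ := rfl
  map_smul' _ _ := rfl

/-- The closure of `{(x ξ, x η) : x ∈ A}`. -/
def graphSpace (A : VonNeumannAlgebra H) (ξ η : H) : Submodule ℂ (WithLp 2 (H × H)) :=
  (LinearMap.range (graphMap A ξ η)).topologicalClosure

instance (A : VonNeumannAlgebra H) (ξ η : H) : CompleteSpace (graphSpace A ξ η) :=
  (Submodule.isClosed_topologicalClosure _).completeSpace_coe

theorem mem_graphSpace {A : VonNeumannAlgebra H} {ξ η : H} {x : H →L[ℂ] H} (hx : x ∈ A) :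
    WithLp.toLp 2 (x ξ, x η) ∈ graphSpace A ξ η :=
  Submodule.le_topologicalClosure _ ⟨⟨x, hx⟩, rfl⟩

theorem graphSpace_induction {A : VonNeumannAlgebra H} {ξ η : H} {p : WithLp 2 (H × H) → Prop}
    (hp : IsClosed {k | p k}) (h : ∀ x ∈ A, p (WithLp.toLp 2 (x ξ, x η))) :
    ∀ k ∈ graphSpace A ξ η, p k := by
  refine fun ζ hζ => closure_minimal (t := {ζ | p ζ}) ?_ hp hζ
  rintro _ ⟨b, rfl⟩
  exact h b b.2

/-- The hypotheses say that S ⊕ T and its adjoint preserve the graph. They do not require S or T to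
commute with A. -/
theorem starProjection_graphSpace_mul {A : VonNeumannAlgebra H} {ξ η : H} {S T : H →L[ℂ] H}
    (h : ∀ x ∈ A, ∃ y ∈ A, y ξ = S (x ξ) ∧ y η = T (x η))
    (hstar : ∀ x ∈ A, ∃ y ∈ A, y ξ = star S (x ξ) ∧ y η = star T (x η)) :
    (graphSpace A ξ η).starProjection * diagOp S T =
      diagOp S T * (graphSpace A ξ η).starProjection := by
  have key : ∀ S T : H →L[ℂ] H, (∀ x ∈ A, ∃ y ∈ A, y ξ = S (x ξ) ∧ y η = T (x η)) →
      ∀ k ∈ graphSpace A ξ η, diagOp S T k ∈ graphSpace A ξ η := by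
    intro S T h
    refine graphSpace_induction ((Submodule.isClosed_topologicalClosure _).preimage
      (diagOp S T).continuous) fun x hx => ?_
    obtain ⟨y, hy, h1, h2⟩ := h x hx
    have h3 : diagOp S T (WithLp.toLp 2 (x ξ, x η)) = WithLp.toLp 2 (y ξ, y η) := by
      rw [h1, h2]
      rfl
    exact h3 ▸ mem_graphSpace hy
  refine starProjection_mul_of_invariant _ (key S T h) ?_
  rw [star_diagOp]
  exact key (star S) (star T) hstar

/-- The second column of the projection onto the closed graph of `x ξ ↦ x η`. -/
theorem exists_graph_blocks (A : VonNeumannAlgebra H) (ξ η : H) :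
    ∃ s t : H →L[ℂ] H, IsSelfAdjoint t ∧
      (∀ S T : H →L[ℂ] H, (∀ x ∈ A, ∃ y ∈ A, y ξ = S (x ξ) ∧ y η = T (x η)) →
        (∀ x ∈ A, ∃ y ∈ A, y ξ = star S (x ξ) ∧ y η = star T (x η)) →
        T * s = s * S ∧ T * t = t * T) ∧
      s ξ + t η = η ∧
      (∀ α β : H, (∀ x ∈ A, ⟪β, x η⟫_ℂ = ⟪α, x ξ⟫_ℂ) →
        ∀ ζ, ⟪β, t ζ⟫_ℂ = ⟪α, star s ζ⟫_ℂ) ∧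
      ∀ x ∈ A, (‖x η‖ ^ 2) ^ 2 ≤ (⟪x η, t (x η)⟫_ℂ).re * (‖x ξ‖ ^ 2 + ‖x η‖ ^ 2) := by
  set p := (graphSpace A ξ η).starProjection with hp
  have hps : IsStarProjection p := isStarProjection_starProjection
  have hsym : ∀ k l, ⟪p k, l⟫_ℂ = ⟪k, p l⟫_ℂ :=
    Submodule.inner_starProjection_left_eq_right _
  set s : H →L[ℂ] H := (WithLp.sndL 2 ℂ H H).comp (p.comp inlL2) with hs
  set t : H →L[ℂ] H := (WithLp.sndL 2 ℂ H H).comp (p.comp inrL2) with ht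
  have hs' : ∀ ζ, s ζ = (p (inlL2 ζ)).snd := fun _ => rfl
  have ht' : ∀ ζ, t ζ = (p (inrL2 ζ)).snd := fun _ => rfl
  have hinr : ∀ (ζ : H) (k : WithLp 2 (H × H)), ⟪inrL2 ζ, k⟫_ℂ = ⟪ζ, k.snd⟫_ℂ := fun ζ k => by
    rw [WithLp.prod_inner_apply, inrL2_apply]; simp
  have hinl : ∀ (ζ : H) (k : WithLp 2 (H × H)), ⟪inlL2 ζ, k⟫_ℂ = ⟪ζ, k.fst⟫_ℂ := fun ζ k => by
    rw [WithLp.prod_inner_apply, inlL2_apply]; simp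
  -- So p(0, ζ) = (s* ζ, t ζ).
  have hss : ∀ ζ, star s ζ = (p (inrL2 ζ)).fst := fun ζ => by
    refine ext_inner_left ℂ fun ω => ?_
    rw [inner_apply_star, hs', ← hinl, ← hsym, ← inner_conj_symm, ← hinr, inner_conj_symm]
  refine ⟨s, t, ?_, ?_, ?_, ?_, ?_⟩
  · refine ContinuousLinearMap.ext fun ζ => ext_inner_left ℂ fun ω => ?_
    rw [inner_apply_star, ht', ht', ← hinr, ← hsym, ← inner_conj_symm, ← hinr, inner_conj_symm]
  · intro S T h h'
    have h1 := starProjection_graphSpace_mul h h'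
    constructor
    · refine ContinuousLinearMap.ext fun ζ => ?_
      have h2 := congrArg (fun U : WithLp 2 (H × H) →L[ℂ] WithLp 2 (H × H) =>
        (U (inlL2 ζ)).snd) h1
      have h3 : diagOp S T (inlL2 ζ) = inlL2 (S ζ) := by
        rw [diagOp_apply, inlL2_apply, inlL2_apply]; simp
      simp only [mul_apply_eq_comp, ← hp, h3] at h2
      rw [mul_apply_eq_comp, mul_apply_eq_comp, hs', hs', h2]
      rfl
    · refine ContinuousLinearMap.ext fun ζ => ?_
      have h2 := congrArg (fun U : WithLp 2 (H × H) →L[ℂ] WithLp 2 (H × H) =>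
        (U (inrL2 ζ)).snd) h1
      have h3 : diagOp S T (inrL2 ζ) = inrL2 (T ζ) := by
        rw [diagOp_apply, inrL2_apply, inrL2_apply]; simp
      simp only [mul_apply_eq_comp, ← hp, h3] at h2
      rw [mul_apply_eq_comp, mul_apply_eq_comp, ht', ht', h2]
      rfl
  · have h1 : p (WithLp.toLp 2 (ξ, η)) = WithLp.toLp 2 (ξ, η) :=
      Submodule.starProjection_eq_self_iff.2 (by simpa using mem_graphSpace (one_mem A))
    have h2 : WithLp.toLp 2 (ξ, η) = inlL2 ξ + inrL2 η := by
      rw [inlL2_apply, inrL2_apply, ← WithLp.toLp_add]; simp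
    rw [hs', ht', ← WithLp.add_snd, ← map_add, ← h2, h1]
    rfl
  · intro α β h ζ
    rw [ht', hss]
    refine graphSpace_induction (A := A) (ξ := ξ) (η := η)
      (p := fun k => ⟪β, k.snd⟫_ℂ = ⟪α, k.fst⟫_ℂ) ?_ h _
      (Submodule.starProjection_apply_mem _ _)
    exact isClosed_eq ((continuous_const).inner (WithLp.continuous_snd ..))
      ((continuous_const).inner (WithLp.continuous_fst ..))
  · intro x hx
    set k : WithLp 2 (H × H) := WithLp.toLp 2 (x ξ, x η) with hk
    have h1 : p k = k := Submodule.starProjection_eq_self_iff.2 (mem_graphSpace hx)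
    -- Cauchy–Schwarz for p(0, x η) against the graph vector k = (x ξ, x η), which p fixes.
    have h2 : ‖x η‖ ^ 2 ≤ ‖p (inrL2 (x η))‖ * ‖k‖ := by
      have h3 : ⟪p (inrL2 (x η)), k⟫_ℂ = ⟪x η, x η⟫_ℂ := by
        rw [hsym, h1, hinr]
        rfl
      have h4 := norm_inner_le_norm (𝕜 := ℂ) (p (inrL2 (x η))) k
      rw [h3, inner_self_eq_norm_sq_to_K] at h4
      simpa using h4
    have h5 : ‖p (inrL2 (x η))‖ ^ 2 = (⟪x η, t (x η)⟫_ℂ).re := by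
      rw [← re_inner_apply_of_isStarProjection hps, hinr, ht']
    have h6 : ‖k‖ ^ 2 = ‖x ξ‖ ^ 2 + ‖x η‖ ^ 2 := by
      rw [WithLp.prod_norm_sq_eq_of_L2]
      rfl
    rw [← h5, ← h6, ← mul_pow]
    gcongr

/-! ### Range projections -/

/-- The projection onto the closure of the range of a self-adjoint operator. -/
theorem exists_rangeProjection {a : H →L[ℂ] H} (ha : IsSelfAdjoint a) :
    ∃ r : H →L[ℂ] H, IsStarProjection r ∧ r * a = a ∧ a * r = a ∧
      (∀ n : H →L[ℂ] H, n * a = 0 → n * r = 0) ∧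
      ∀ S : H →L[ℂ] H, S * a = a * S → star S * a = a * star S → S * r = r * S := by
  set K := (LinearMap.range a.toLinearMap).topologicalClosure with hK
  have : CompleteSpace K := (Submodule.isClosed_topologicalClosure _).completeSpace_coe
  have hps : IsStarProjection K.starProjection := isStarProjection_starProjection
  have h1 : K.starProjection * a = a := ContinuousLinearMap.ext fun ω =>
    Submodule.starProjection_eq_self_iff.2 (Submodule.le_topologicalClosure _ ⟨ω, rfl⟩)
  have inv : ∀ S : H →L[ℂ] H, S * a = a * S → ∀ ζ ∈ K, S ζ ∈ K := fun S hS => by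
    refine mem_topologicalClosure_of_forall ?_
    rintro _ ⟨ω, rfl⟩
    exact ⟨S ω, (congrArg (fun T : H →L[ℂ] H => T ω) hS).symm⟩
  refine ⟨K.starProjection, hps, h1, ?_, fun n hn => ?_, fun S hS hS' =>
    (starProjection_mul_of_invariant K (inv S hS) (inv _ hS')).symm⟩
  · simpa [hps.isSelfAdjoint.star_eq, ha.star_eq] using congrArg star h1
  · have h2 : ∀ ζ ∈ K, n ζ = 0 := fun ζ hζ =>
      closure_minimal (t := {ζ | n ζ = 0}) (by
        rintro _ ⟨ω, rfl⟩
        exact congrArg (fun T : H →L[ℂ] H => T ω) hn) (isClosed_eq (by fun_prop) (by fun_prop)) hζ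
    exact ContinuousLinearMap.ext fun ω => h2 _ (Submodule.starProjection_apply_mem _ _)

omit [CompleteSpace H] in
theorem re_inner_nonneg {a : H →L[ℂ] H} (ha : 0 ≤ a) (ζ : H) : 0 ≤ (⟪ζ, a ζ⟫_ℂ).re :=
  ((ContinuousLinearMap.nonneg_iff_isPositive a).1 ha).re_inner_nonneg_right ζ

theorem apply_eq_zero_of_re_inner {a : H →L[ℂ] H} (ha : 0 ≤ a) {ζ : H}
    (h : (⟪ζ, a ζ⟫_ℂ).re = 0) : a ζ = 0 := by
  obtain ⟨s, rfl⟩ := CStarAlgebra.nonneg_iff_eq_star_mul_self.1 ha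
  rw [mul_apply_eq_comp, inner_apply_star, inner_self_eq_norm_sq_to_K] at h
  have h1 : ‖s ζ‖ ^ 2 = 0 := by exact_mod_cast h
  rw [mul_apply_eq_comp, norm_eq_zero.1 (pow_eq_zero_iff two_ne_zero |>.1 h1), map_zero]

/-! ### Boundedness of the intertwining vector -/

namespace IsStandardForm

variable {M : VonNeumannAlgebra H} {ξ : H} (hM : IsStandardForm M ξ)
include hM

/-- A vector `η` that intertwines a set `D` with the right action is bounded by `ξ` as soon as
it is so on all projections of `D' ∩ M` below `q`. -/
theorem norm_apply_le_of_forall_projection {q : H →L[ℂ] H} {η : H}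
    {D : Set (H →L[ℂ] H)} (hq : IsStarProjection q) (hqM : q ∈ M) (hqD : q ∈ D) (hDM : D ⊆ M)
    (hDq : ∀ b ∈ D, b * q = b ∧ q * b = b) (hqη : q η = η)
    (hD : ∀ b ∈ D, ∃ c ∈ M, b η = conjOp M ξ (star c) η ∧ star b η = conjOp M ξ c η)
    (hr : ∀ r ∈ M, IsStarProjection r → q * r = r → (∀ b ∈ D, b * r = r * b) →
      ‖r η‖ ≤ ‖r ξ‖) :
    ∀ x ∈ M.commutant, ‖x η‖ ≤ ‖x ξ‖ := by
  obtain ⟨s, t, hts, hcomm, hη, hpair, hbound⟩ := exists_graph_blocks M.commutant ξ η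
  have hcM : ∀ x ∈ M.commutant, ∀ y ∈ M, ∀ ζ, x (y ζ) = y (x ζ) := fun x hx y hy ζ =>
    (congrArg (fun T : H →L[ℂ] H => T ζ) (VonNeumannAlgebra.mem_commutant_iff.1 hx y hy)).symm
  have hst : ∀ x ∈ M.commutant, x * s = s * x ∧ x * t = t * x := fun x hx =>
    hcomm x x (fun y hy => ⟨x * y, mul_mem hx hy, rfl, rfl⟩)
      (fun y hy => ⟨star x * y, mul_mem (star_mem hx) hy, rfl, rfl⟩)
  have hsM : s ∈ M := mem_of_forall_commutant fun x hx => (hst x hx).1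
  have htM : t ∈ M := mem_of_forall_commutant fun x hx => (hst x hx).2
  -- Right multiplication by c sends (x ξ, x η) to (c x ξ, b x η), so c ⊕ b preserves the graph and
  -- b commutes with t.
  have htD : ∀ b ∈ D, b * t = t * b := fun b hb => by
    obtain ⟨c, hc, h1, h2⟩ := hD b hb
    refine (hcomm c b (fun x hx => ⟨x * conjOp M ξ (star c),
      mul_mem hx (hM.conjOp_mem_commutant (star_mem hc)), ?_, ?_⟩) (fun x hx =>
        ⟨x * conjOp M ξ c, mul_mem hx (hM.conjOp_mem_commutant hc), ?_, ?_⟩)).2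
    · rw [mul_apply_eq_comp, hM.conjOp_apply_self (star_mem hc), star_star, hcM x hx c hc]
    · rw [mul_apply_eq_comp, ← h1, hcM x hx b (hDM hb)]
    · rw [mul_apply_eq_comp, hM.conjOp_apply_self hc, hcM x hx _ (star_mem hc)]
    · rw [mul_apply_eq_comp, ← h2, hcM x hx _ (star_mem (hDM hb))]
  -- `⟨t ξ, m ξ⟩ = ⟨m* η, (1 - t) η⟩`
  have hident : ∀ m ∈ M, ⟪m ξ, t ξ⟫_ℂ = ⟪η - t η, star m η⟫_ℂ := fun m hm => by
    -- Here α = J m* η and β = m ξ; then s* ξ = J s ξ, and s ξ = η - t η because p fixes (ξ, η).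
    rw [hpair (modularConj M ξ (star m η)) (m ξ) (fun x hx => ?_) ξ]
    · rw [← hM.modularConj_apply hsM, hM.inner_modularConj, ← eq_sub_of_add_eq hη]
    · rw [hM.inner_modularConj_left, hM.modularConj_apply_commutant hx, inner_star_apply x ξ,
        hcM x hx _ (star_mem hm), inner_apply_star]
  -- For η = y ξ, formally t = yy*(1 + yy*)⁻¹, so t ≤ 1/2 is the condition ‖y‖ ≤ 1.
  set u : H →L[ℂ] H := t - (1 / 2 : ℂ) • 1 with hu
  have hus : IsSelfAdjoint u :=
    hts.sub (IsSelfAdjoint.smul (by simp [IsSelfAdjoint]) (IsSelfAdjoint.one _))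
  have htu : t = u + (1 / 2 : ℂ) • 1 := by rw [hu, sub_add_cancel]
  have hucomm : ∀ S : H →L[ℂ] H, S * t = t * S → S * u⁺ = u⁺ * S := fun S hS => by
    have h1 : Commute u S := by
      rw [hu]
      exact (Commute.sub_left (show Commute t S from hS.symm)
        ((Commute.one_left S).smul_left _))
    exact (h1.cfcₙ_real _).eq.symm
  set a := u⁺ with ha
  set n := u⁻ with hn
  have ha0 : 0 ≤ a := CFC.posPart_nonneg u
  have hn0 : 0 ≤ n := CFC.negPart_nonneg u
  have huan : u = a - n := (CFC.posPart_sub_negPart u hus).symm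
  have hna : n * a = 0 := CFC.negPart_mul_posPart u
  have haM : a ∈ M := mem_of_forall_commutant fun x hx => hucomm x (hst x hx).2
  obtain ⟨r, hrp, hra, har, hrn, hrc⟩ := exists_rangeProjection ha0.isSelfAdjoint
  have hqs : star q = q := hq.isSelfAdjoint.star_eq
  have hqt : q * t = t * q := htD q hqD
  have hqa : q * a = a * q := hucomm q hqt
  have hqr : q * r = r * q := hrc q hqa (by rw [hqs, hqa])
  have hrM : r ∈ M := mem_of_forall_commutant fun x hx =>
    hrc x (hucomm x (hst x hx).2) (hucomm _ (hst _ (star_mem hx)).2)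
  have hrqp : IsStarProjection (r * q) := hrp.mul hq hqr.symm
  have hur : u * r = a := by rw [huan, sub_mul, har, hrn n hna, sub_zero]
  have htr : t * (r * q) = a * q + (1 / 2 : ℂ) • (r * q) := by
    rw [htu, add_mul, ← mul_assoc, hur, smul_mul_assoc, one_mul]
  have hst' : ∀ b ∈ D, star b * t = t * star b := fun b hb => by
    have := congrArg star (htD b hb)
    rw [star_mul, star_mul, hts.star_eq] at this
    exact this.symm
  have hmain := hr (r * q) (mul_mem hrM hqM) hrqp
    (by rw [hqr.symm, ← mul_assoc, hq.isIdempotentElem.eq]) (fun b hb => by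
      have h1 : b * r = r * b := hrc b (hucomm b (htD b hb)) (hucomm _ (hst' b hb))
      rw [← mul_assoc, h1, mul_assoc, (hDq b hb).1, mul_assoc, (hDq b hb).2])
  have hquad : ∀ ζ, (⟪t ζ, (r * q) ζ⟫_ℂ).re =
      (⟪q ζ, a (q ζ)⟫_ℂ).re + 1 / 2 * ‖(r * q) ζ‖ ^ 2 := fun ζ => by
    have h1 : a * q = star q * a * q := by
      rw [hqs, hqa, mul_assoc, hq.isIdempotentElem.eq]
    have h2 : ⟪t ζ, (r * q) ζ⟫_ℂ = ⟪q ζ, a (q ζ)⟫_ℂ + (1 / 2 : ℂ) * ⟪ζ, (r * q) ζ⟫_ℂ := by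
      rw [← inner_apply_star, hts.star_eq, ← mul_apply_eq_comp, htr, h1, add_apply,
        inner_add_right, smul_apply, inner_smul_right, mul_assoc, mul_apply_eq_comp,
        inner_apply_star, mul_apply_eq_comp]
    have h3 : ((1 / 2 : ℂ) * ⟪ζ, (r * q) ζ⟫_ℂ).re = 1 / 2 * (⟪ζ, (r * q) ζ⟫_ℂ).re := by
      rw [show (1 / 2 : ℂ) = ((1 / 2 : ℝ) : ℂ) by norm_num, Complex.re_ofReal_mul]
    rw [h2, Complex.add_re, h3, re_inner_apply_of_isStarProjection hrqp]
  -- Taking m = r q in `hident` gives ⟨qξ, a qξ⟩ + ⟨qη, a qη⟩ = ½(‖rqη‖² - ‖rqξ‖²) ≤ 0. Both terms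
  -- on the left are nonnegative, so a q ξ = 0, and ξ separates M.
  have haq : a * q = 0 := by
    have h1 := congrArg Complex.re (hident (r * q) (mul_mem hrM hqM))
    rw [hrqp.isSelfAdjoint.star_eq, inner_sub_left, Complex.sub_re, hquad,
      re_inner_apply_of_isStarProjection hrqp] at h1
    have h2 : (⟪(r * q) ξ, t ξ⟫_ℂ).re = (⟪t ξ, (r * q) ξ⟫_ℂ).re :=
      inner_re_symm (𝕜 := ℂ) _ _
    rw [h2, hquad] at h1
    have h3 : ‖(r * q) η‖ ^ 2 ≤ ‖(r * q) ξ‖ ^ 2 := by gcongr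
    have h4 := re_inner_nonneg ha0 (q ξ)
    have h5 := re_inner_nonneg ha0 (q η)
    exact hM.eq_zero_of_apply (mul_mem haM hqM)
      (apply_eq_zero_of_re_inner ha0 (ζ := q ξ) (by linarith))
  intro x hx
  have h1 := hbound x hx
  have h2 : a (x η) = 0 := by
    rw [← hqη, hcM x hx q hqM, ← mul_apply_eq_comp, haq, zero_apply]
  have h3 : (⟪x η, t (x η)⟫_ℂ).re ≤ 1 / 2 * ‖x η‖ ^ 2 := by
    have h4 : ⟪x η, t (x η)⟫_ℂ = -⟪x η, n (x η)⟫_ℂ + (1 / 2 : ℝ) * ⟪x η, x η⟫_ℂ := by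
      rw [htu, huan, add_apply, sub_apply, h2, zero_sub, inner_add_right, inner_neg_right,
        smul_apply, inner_smul_right, one_apply_eq_self]
      norm_num
    have h5 := re_inner_nonneg hn0 (x η)
    have h6 : (⟪x η, x η⟫_ℂ).re = ‖x η‖ ^ 2 := by
      rw [inner_self_eq_norm_sq_to_K]; norm_cast
    rw [h4, Complex.add_re, Complex.neg_re, Complex.re_ofReal_mul, h6]
    linarith
  -- Dividing by ‖x η‖² leaves ‖x η‖² ≤ ½(‖x ξ‖² + ‖x η‖²).
  have h7 : (‖x η‖ ^ 2) ^ 2 ≤ 1 / 2 * ‖x η‖ ^ 2 * (‖x ξ‖ ^ 2 + ‖x η‖ ^ 2) :=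
    h1.trans (mul_le_mul_of_nonneg_right h3 (by positivity))
  rcases eq_or_ne (x η) 0 with h8 | h8
  · simp [h8]
  · have h9 : 0 < ‖x η‖ ^ 2 := by positivity
    refine (sq_le_sq₀ (norm_nonneg _) (norm_nonneg _)).1 (le_of_mul_le_mul_left ?_ h9)
    linarith [h7]

end IsStandardForm

/-! ### Construction of the intertwiner -/

theorem mul_eq_of_mul_star_le {V e : H →L[ℂ] H} (he : IsStarProjection e)
    (h : V * star V ≤ e) : e * V = V := by
  have h1 := star_right_conjugate_le_conjugate h (1 - e)
  have h2 : (1 - e) * e * star (1 - e) = 0 := by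
    rw [sub_mul, one_mul, he.isIdempotentElem.eq, sub_self, zero_mul]
  have h3 : (1 - e) * (V * star V) * star (1 - e) = ((1 - e) * V) * star ((1 - e) * V) := by
    rw [star_mul]
    simp only [mul_assoc]
  rw [h2, h3] at h1
  have h4 := CStarRing.mul_star_self_eq_zero_iff _ |>.1
    (le_antisymm h1 (mul_star_self_nonneg ((1 - e) * V)))
  rw [sub_mul, one_mul, sub_eq_zero] at h4
  exact h4.symm

theorem mul_eq_of_star_mul_self_mul {V q : H →L[ℂ] H} (hq : IsStarProjection q)
    (h : star V * V * q = star V * V) : V * q = V := by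
  have h' : q * (star V * V) = star V * V := by
    simpa [hq.isSelfAdjoint.star_eq] using congrArg star h
  rw [← sub_eq_zero, ← CStarRing.star_mul_self_eq_zero_iff]
  have h1 : star (V * q - V) * (V * q - V) =
      q * (star V * V) * q - q * (star V * V) - (star V * V * q - star V * V) := by
    simp only [star_sub, star_mul, hq.isSelfAdjoint.star_eq, mul_sub, sub_mul, mul_assoc]
    abel
  rw [h1, h', h]
  simp

namespace IsStandardForm

variable {M B : VonNeumannAlgebra H} {ξ : H} (hM : IsStandardForm M ξ)
include hM

theorem exists_intertwiner (hBM : B ≤ M)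
    (hcomm : relativeCommutant B M ⊆ (B : Set (H →L[ℂ] H)))
    {q P : H →L[ℂ] H} (hqB : q ∈ B) (hq : IsStarProjection q) (hP : IsStarProjection P)
    (hPq : P ∈ cutDown (relativeCommutant B (basicConstruction M B ξ)) q)
    (hsub : Subequivalent (basicConstruction M B ξ) P (jonesProjection B ξ))
    (htr : ∀ r ∈ cutDown (centre B) q, IsStarProjection r →
      canonicalTrace M B ξ (P * r) ≤ ENNReal.ofReal (vectorTrace ξ (q * r)).re) :
    ∃ v ∈ intertwiners M B, P = star v * jonesProjection B ξ * v := by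
  obtain ⟨V, hVN, hVP, hVe⟩ := hsub
  set e := jonesProjection B ξ with he
  have hes : star e = e := star_jonesProjection
  have he2 : e * e = e := jonesProjection_mul_self
  have heV : e * V = V := mul_eq_of_mul_star_le jonesProjection_isStarProjection hVe
  have hVse : star V * e = star V := by simpa [hes] using congrArg star heV
  have hVPV : V * P = V :=
    mul_eq_of_star_mul_self_mul hP (by rw [hVP, hP.isIdempotentElem.eq])
  have hVq : V * q = V :=
    mul_eq_of_star_mul_self_mul hq (by rw [hVP, mul_eq_of_mem_cutDown hq hPq])
  have hPVs : P * star V = star V := by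
    simpa [hP.isSelfAdjoint.star_eq] using congrArg star hVPV
  have hqVs : q * star V = star V := by
    simpa [hq.isSelfAdjoint.star_eq] using congrArg star hVq
  have hVm : IsRightModular M B ξ V := hM.isRightModular_of_mem_basicConstruction hBM hVN
  have hVsm := hM.isRightModular_star hVm
  set η := star V ξ with hη
  have hqη : q η = η := by rw [hη, ← mul_apply_eq_comp, hqVs]
  have hcB : ∀ c ∈ B, e * c = c * e := fun c hc => jonesProjection_mul hc
  -- the homomorphism `b ↦ V b V*` takes values in `B e_B`
  have hpull : ∀ b ∈ B, ∃ c ∈ B, V * b * star V = c * e := fun b hb =>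
    hM.exists_mem_mul_jonesProjection hBM
      ((hVm.mul (hM.isRightModular_of_mem hBM (hBM hb))).mul hVsm)
      (by rw [← mul_assoc, ← mul_assoc, ← he, heV]) (by rw [mul_assoc, ← he, hVse])
  have hint : ∀ b ∈ B, ∀ c ∈ B, V * (q * b * q) * star V = c * e →
      (q * b * q) * star V = star V * c := fun b hb c hc h => by
    have h1 := congrArg (fun T => star V * T) h
    simp only [← mul_assoc (star V)] at h1
    rw [hVP, mul_assoc (star V) c, ← hcB c hc, ← mul_assoc (star V) e, hVse] at h1
    rw [← h1, ← commute_corner_of_mem_cutDown hqB hq hPq hb, mul_assoc _ P, hPVs]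
  have hintη : ∀ b ∈ B, ∀ c ∈ B, V * (q * b * q) * star V = c * e →
      (q * b * q) η = conjOp M ξ (star c) η := fun b hb c hc h => by
    rw [hη, ← mul_apply_eq_comp, hint b hb c hc h, ← mul_apply_eq_comp (conjOp M ξ _),
      ← hVsm _ (star_mem hc), mul_apply_eq_comp, mul_apply_eq_comp,
      hM.conjOp_apply_self (hBM (star_mem hc)), star_star]
  have hadj : ∀ b c, c ∈ B → V * (q * b * q) * star V = c * e →
      V * (q * star b * q) * star V = star c * e := fun b c hc h => by
    rw [← hcB _ (star_mem hc)]
    simpa only [star_mul, star_star, hes, hq.isSelfAdjoint.star_eq, mul_assoc] using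
      congrArg star h
  set D : Set (H →L[ℂ] H) := {d | ∃ b ∈ B, q * b * q = d} with hD
  have hbound : ∀ x ∈ M.commutant, ‖x η‖ ≤ ‖x ξ‖ := by
    refine hM.norm_apply_le_of_forall_projection hq (hBM hqB) (D := D)
      ⟨1, one_mem B, by rw [mul_one, hq.isIdempotentElem.eq]⟩ ?_ ?_ hqη ?_ ?_
    · rintro _ ⟨b, hb, rfl⟩
      exact hBM (mul_mem (mul_mem hqB hb) hqB)
    · rintro _ ⟨b, hb, rfl⟩
      refine ⟨?_, ?_⟩
      · rw [mul_assoc, hq.isIdempotentElem.eq]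
      · rw [← mul_assoc, ← mul_assoc, hq.isIdempotentElem.eq]
    · rintro _ ⟨b, hb, rfl⟩
      obtain ⟨c, hc, h1⟩ := hpull _ (mul_mem (mul_mem hqB hb) hqB)
      refine ⟨c, hBM hc, hintη b hb c hc h1, ?_⟩
      have h3 := hintη (star b) (star_mem hb) (star c) (star_mem hc) (hadj b c hc h1)
      simpa only [star_mul, star_star, hq.isSelfAdjoint.star_eq, mul_assoc] using h3
    · intro r hrM hrp hqr hrD
      have hr : r ∈ cutDown (centre B) q :=
        cutDown_subset (relativeCommutant_subset_centre hcomm) q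
          (mem_cutDown_of_commute_corner hBM hq hqB hrM hrp hqr fun b hb => hrD _ ⟨b, hb, rfl⟩)
      have h1 := htr r hr hrp
      -- The one-element family V is admissible since V* e V = P ≤ 1, and its term in the supremum
      -- is ‖r η‖².
      have h2 : ENNReal.ofReal (‖r η‖ ^ 2) ≤ canonicalTrace M B ξ (P * r) := by
        have hfam : (∀ i : Fin 1, (fun _ => V) i ∈ basicConstruction M B ξ ∧
            IsPartialIsometry ((fun _ => V) i)) ∧
            ∑ i : Fin 1, star ((fun _ => V) i) * jonesProjection B ξ * (fun _ => V) i ≤ 1 := by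
          refine ⟨fun _ => ⟨hVN, ?_⟩, ?_⟩
          · rw [IsPartialIsometry, mul_assoc, hVP, hVPV]
          · simp only [Fin.sum_univ_one]
            rw [← he, hVse, hVP]
            exact hP.le_one
        refine le_trans (le_of_eq ?_)
          (le_iSup_of_le 1 (le_iSup_of_le (fun _ => V) (le_iSup_of_le hfam le_rfl)))
        rw [Fin.sum_univ_one, mul_comm_of_mem_cutDown hqB hPq hr, mul_apply_eq_comp,
          ← mul_apply_eq_comp P, hPVs, ← hη, re_inner_apply_of_isStarProjection hrp]
      have h3 := h2.trans h1
      rw [vectorTrace, hqr, re_inner_apply_of_isStarProjection hrp,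
        ENNReal.ofReal_le_ofReal_iff (by positivity)] at h3
      exact (sq_le_sq₀ (norm_nonneg _) (norm_nonneg _)).1 h3
  obtain ⟨y, hyM, hyξ, hy1⟩ := exists_mem_apply_eq (C := 1) hM.dense_commutant
    (fun x hx => by simpa using hbound x hx)
  have hVy : star V = y * e := by
    refine FiniteInclusion.eq_of_mul_jonesProjection (B := B) (ξ := ξ) hVse
      (by rw [mul_assoc, ← he, he2]) fun b hb => ?_
    have h1 : b ξ = conjOp M ξ (star b) ξ := by
      rw [hM.conjOp_apply_self (hBM (star_mem hb)), star_star]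
    rw [mul_apply_eq_comp, he, jonesProjection_apply hb, h1, ← mul_apply_eq_comp,
      hVsm _ (star_mem hb), ← mul_apply_eq_comp y,
      hM.isRightModular_of_mem hBM hyM _ (star_mem hb), mul_apply_eq_comp, mul_apply_eq_comp, hyξ]
  have hVw : V = e * star y := by simpa [hes] using congrArg star hVy
  have hPy : P = y * e * star y := by
    rw [← hVP, hVw, star_mul, star_star, hes, ← mul_assoc, mul_assoc y, he2]
  have hintM : ∀ b ∈ B, ∀ c ∈ B, V * (q * b * q) * star V = c * e →
      (q * b * q) * y = y * c := fun b hb c hc h => by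
    refine hM.eq_of_mul_jonesProjection (B := B)
      (mul_mem (hBM (mul_mem (mul_mem hqB hb) hqB)) hyM) (mul_mem hyM (hBM hc)) ?_
    have h1 := hint b hb c hc h
    rw [hVy, mul_assoc y e, hcB c hc] at h1
    rw [← he, mul_assoc _ y, h1, mul_assoc]
  -- This p ∈ B, with V V* = p e, will be the final projection v v* of v = y*.
  obtain ⟨p, hpB, hp⟩ := hpull 1 (one_mem B)
  rw [mul_one] at hp
  have hpV : p * V = V := by
    rw [← heV, ← mul_assoc, ← hp, mul_assoc, heV, hVP, hVPV]
  have hpy : p * star y = star y := by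
    refine hM.eq_of_jonesProjection_mul (B := B) (mul_mem (hBM hpB) (star_mem hyM))
      (star_mem hyM) ?_
    rw [← he, ← mul_assoc, hcB p hpB, mul_assoc, ← hVw, hpV]
  have hpp : p * p = p := by
    refine hM.eq_of_mul_jonesProjection (B := B) (mul_mem (hBM hpB) (hBM hpB)) (hBM hpB) ?_
    rw [← he, mul_assoc, ← hp, ← mul_assoc, hpV]
  have hps : star p = p := by
    refine hM.eq_of_mul_jonesProjection (B := B) (star_mem (hBM hpB)) (hBM hpB) ?_
    have h1 := congrArg star hp
    rw [star_mul, star_mul, star_star, hes, hp, hcB _ (star_mem hpB)] at h1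
    exact h1.symm
  have hyp : star y * y = p := by
    have hle : star y * y ≤ p := by
      have h1 : ‖y‖ ≤ 1 := y.opNorm_le_bound zero_le_one hy1
      have h2 : star y * y ≤ 1 := by
        refine (CStarAlgebra.norm_le_one_iff_of_nonneg _ (star_mul_self_nonneg y)).1 ?_
        rw [CStarRing.norm_star_mul_self]
        exact mul_le_one₀ h1 (norm_nonneg _) h1
      have h3 := star_right_conjugate_le_conjugate h2 p
      have h4 : y * p = y := by simpa [hps] using congrArg star hpy
      rwa [hps, mul_one, hpp, ← mul_assoc, hpy, mul_assoc, h4] at h3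
    -- Both y* y and p have trace ‖η‖², so y* y ≤ p is an equality by faithfulness.
    refine (sub_eq_zero.1 (hM.eq_zero_of_apply
      (sub_mem (hBM hpB) (mul_mem (star_mem hyM) hyM))
      (apply_eq_zero_of_re_inner (sub_nonneg.2 hle) ?_))).symm
    have h5 : ⟪ξ, p ξ⟫_ℂ = ⟪η, η⟫_ℂ := by
      have h6 : p ξ = V η := by
        rw [hη, ← mul_apply_eq_comp, hp, mul_apply_eq_comp, he, jonesProjection_self]
      rw [h6, ← inner_star_apply]
    have h7 : ⟪ξ, (star y * y) ξ⟫_ℂ = ⟪η, η⟫_ℂ := by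
      rw [mul_apply_eq_comp, inner_apply_star, hyξ]
    rw [sub_apply, inner_sub_right, h5, h7, sub_self, Complex.zero_re]
  have hqy : q * y = y :=
    hM.eq_of_apply (mul_mem (hBM hqB) hyM) hyM (by rw [mul_apply_eq_comp, hyξ, hqη])
  have hyq : star y * q = star y := by
    simpa [hq.isSelfAdjoint.star_eq] using congrArg star hqy
  have hpi : IsPartialIsometry (star y) := by
    rw [IsPartialIsometry, star_star, hyp, hpy]
  refine ⟨star y, ⟨star_mem hyM, hpi, fun b hb => ?_, ?_⟩, by rw [star_star, hPy]⟩
  · obtain ⟨c, hc, h1⟩ := hpull _ (mul_mem (mul_mem hqB hb) hqB)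
    have h2 : star y * b * star (star y) = p * c := by
      calc star y * b * star (star y) = (star y * q) * b * (q * y) := by rw [hyq, hqy, star_star]
        _ = star y * ((q * b * q) * y) := by simp only [mul_assoc]
        _ = p * c := by rw [hintM b hb c hc h1, ← mul_assoc, hyp]
    rw [h2]
    exact mul_mem hpB hc
  -- For a = q b q, a y y* = y c y* = y y* a, so v* v = y y* is cut from q by an element of B' ∩ M ⊆
  -- B.
  · have h0 : star (star y) * star y ∈ cutDown (relativeCommutant B M) q := by
      refine mem_cutDown_of_commute_corner hBM hq hqB
        (mul_mem (star_mem (star_mem hyM)) (star_mem hyM)) hpi.isStarProjection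
        (by rw [star_star, ← mul_assoc, hqy]) fun b hb => ?_
      obtain ⟨c, hc, h1⟩ := hpull _ (mul_mem (mul_mem hqB hb) hqB)
      have h2 := hintM b hb c hc h1
      have h3 := congrArg star
        (hintM (star b) (star_mem hb) (star c) (star_mem hc) (hadj b c hc h1))
      simp only [star_mul, star_star, hq.isSelfAdjoint.star_eq] at h3
      rw [star_star, ← mul_assoc, h2, mul_assoc y, mul_assoc y, mul_assoc q, h3]
    obtain ⟨z, hz, h4⟩ := h0
    rw [h4]
    exact mul_mem (hcomm hz) hqB

end IsStandardForm

end FiniteInclusion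

end

theorem mainTheorem5 {H : Type*} [NormedAddCommGroup H] [InnerProductSpace ℂ H]
    [CompleteSpace H] [TopologicalSpace.SeparableSpace H]
    (M B : VonNeumannAlgebra H) (ξ : H)
    (hM : FiniteInclusion.IsStandardForm M ξ) (hBM : B ≤ M)
    (hcomm : FiniteInclusion.relativeCommutant B M ⊆ (B : Set (H →L[ℂ] H)))
    (q : H →L[ℂ] H) (hqB : q ∈ B) (hq : IsStarProjection q)
    (P : H →L[ℂ] H) (hP : IsStarProjection P)
    (hPq : P ∈ FiniteInclusion.cutDown
      (FiniteInclusion.relativeCommutant B (FiniteInclusion.basicConstruction M B ξ)) q) :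
    ((∃ v ∈ FiniteInclusion.intertwiners M B,
        P = star v * FiniteInclusion.jonesProjection B ξ * v) ↔
      FiniteInclusion.Subequivalent (FiniteInclusion.basicConstruction M B ξ) P
          (FiniteInclusion.jonesProjection B ξ) ∧
        ∀ r ∈ FiniteInclusion.cutDown (FiniteInclusion.centre B) q, IsStarProjection r →
          FiniteInclusion.canonicalTrace M B ξ (P * r) ≤
            ENNReal.ofReal (FiniteInclusion.vectorTrace ξ (q * r)).re) ∧
    (∀ v ∈ FiniteInclusion.intertwiners M B,
      P = star v * FiniteInclusion.jonesProjection B ξ * v →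
        star v * v ∈ FiniteInclusion.cutDown (FiniteInclusion.centre B) q) := by
  refine ⟨⟨?_, ?_⟩, ?_⟩
  · rintro ⟨v, hv, hPv⟩
    exact hM.subequivalent_and_trace_le hBM hqB hq hPq hv hPv
  · rintro ⟨hsub, htr⟩
    exact hM.exists_intertwiner hBM hcomm hqB hq hP hPq hsub htr
  · intro v hv hPv
    exact hM.star_mul_self_mem_cutDown hBM hcomm hqB hq hP hPq hv hPv
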